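/- Let $C$ be an Abelian von Neumann algebra, with positive part $C^+$. A Banach $C$-bimodule $Z$ is in ${\rm CNRM}_C$ if it is central ($cz=zc$ for all $c\in C$, $z\in Z$) and there are Hilbert spaces $\mathcal H,\mathcal K$ with normal $*$-representations $\pi:C\to B(\mathcal H)$, $\sigma:C\to B(\mathcal K)$ and a linear isometry $\Phi:Z\to B(\mathcal K,\mathcal H)$ with $\Phi(azb)=\pi(a)\Phi(z)\sigma(b)$ for $a,b\in C$, $z\in Z$; such a $\Phi$ is called a normal embedding of $Z$. For $X,Y\in{\rm CNRM}_C$ let $X\otimes^\nu_C Y$ be the completion of the algebraic tensor product $X\otimes_C Y$ in the norm $\nu_C(w)=\sup\|\phi(w)\|$, where $\phi$ runs over all $C$-bilinear contractions from $X\times Y$ into normal representable $C$-bimodules, identified with the induced linear maps on $X\otimes_CY$. A norm closed central $C$-sub-bimodule $W$ of $B(\mathcal K,\mathcal H)$ is called strong if $\sum_{j\in\mathbb J}p_jz_j\in W$ (weak* convergent sum) for every bounded family $(z_j)_{j\in\mathbb J}$ in $W$ and every orthogonal family $(p_j)_{j\in\mathbb J}$ of projections in $C$. **Theorem.** Let $X,Y\in{\rm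 CNRM}_C$. Then $X\otimes^\nu_CY\in{\rm CNRM}_C$. For every normal embedding of $X\otimes^\nu_CY$ into a space $B(\mathcal K,\mathcal H)$ there is a smallest strong $C$-bimodule $X\widetilde\otimes^\nu Y\subseteq B(\mathcal K,\mathcal H)$ containing (the image of) $X\otimes^\nu_CY$, and every $w\in X\widetilde\otimes^\nu Y$ can be represented in the form $$w=\sum_{j\in\mathbb J}c_j\,x_j\otimes_Cy_j,\qquad x_j\in X,\ \|x_j\|\le1,\quad y_j\in Y,\ \|y_j\|\le1,\quad c_j\in C^+,$$ for some index set $\mathbb J$, where the sum $\sum_{j\in\mathbb J}c_j$ weak* converges in $C$ and the sum representing $w$ weak* converges in $B(\mathcal K,\mathcal H)$. Moreover, $\|w\|$ is equal to the infimum of $\big\|\sum_{j\in\mathbb J}c_j\big\|$ over all such representations of $w$. -/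

import Mathlib

open scoped TensorProduct IsMulCommutative

universe u

noncomputable section

namespace CNRM

section Operators

variable {K H : Type u}
  [NormedAddCommGroup K] [InnerProductSpace ℂ K]
  [NormedAddCommGroup H] [InnerProductSpace ℂ H]

/-- `∑ j, f j = T` in the weak* (ultraweak) topology of `B(K, H)`.  The weak* continuous
functionals are `S ↦ ∑ n, ⟪η n, S (ξ n)⟫` with `ξ`, `η` square summable sequences of vectors, and
convergence is that of the net of finite partial sums. -/
def HasWeakStarSum {J : Type u} (f : J → K →L[ℂ] H) (T : K →L[ℂ] H) : Prop :=
  ∀ (ξ : ℕ → K) (η : ℕ → H),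
    Summable (fun n => ‖ξ n‖ ^ 2) → Summable (fun n => ‖η n‖ ^ 2) →
      HasSum (fun j => ∑' n, inner ℂ (η n) (f j (ξ n))) (∑' n, inner ℂ (η n) (T (ξ n)))

end Operators

section Bimodules

variable {H₀ : Type u} [NormedAddCommGroup H₀] [InnerProductSpace ℂ H₀] [CompleteSpace H₀]

/-- A `*`-representation of a von Neumann algebra is normal if it preserves least upper bounds
of (bounded) increasing nets. -/
def IsNormal (C : VonNeumannAlgebra H₀) {H : Type u}
    [NormedAddCommGroup H] [InnerProductSpace ℂ H] [CompleteSpace H]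
    (π : C.toStarSubalgebra →⋆ₐ[ℂ] (H →L[ℂ] H)) : Prop :=
  ∀ (S : Set C.toStarSubalgebra) (s : C.toStarSubalgebra),
    S.Nonempty → DirectedOn (· ≤ ·) S → IsLUB S s → IsLUB (π '' S) (π s)

/-- An isometric embedding of a central `C`-bimodule `Z` (both actions are the given `•`)
into `B(K, H)` as a `C`-bimodule, where `H` and `K` are normal Hilbert `C`-modules. -/
structure NormalEmbedding (C : VonNeumannAlgebra H₀) (Z K H : Type u)
    [NormedAddCommGroup Z] [NormedSpace ℂ Z] [Module C.toStarSubalgebra Z]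
    [NormedAddCommGroup K] [InnerProductSpace ℂ K] [CompleteSpace K]
    [NormedAddCommGroup H] [InnerProductSpace ℂ H] [CompleteSpace H] where
  left : C.toStarSubalgebra →⋆ₐ[ℂ] (H →L[ℂ] H)
  right : C.toStarSubalgebra →⋆ₐ[ℂ] (K →L[ℂ] K)
  left_normal : IsNormal C left
  right_normal : IsNormal C right
  emb : Z →ₗᵢ[ℂ] (K →L[ℂ] H)
  emb_left : ∀ (c : C.toStarSubalgebra) (z : Z), emb (c • z) = left c ∘L emb z
  emb_right : ∀ (c : C.toStarSubalgebra) (z : Z), emb (c • z) = emb z ∘L right c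

/-- `Z` is a central normal representable (Banach) `C`-bimodule. -/
def IsCNRM (C : VonNeumannAlgebra H₀) (Z : Type u)
    [NormedAddCommGroup Z] [NormedSpace ℂ Z] [Module C.toStarSubalgebra Z] : Prop :=
  CompleteSpace Z ∧
    ∃ (K H : Type u)
      (_ : NormedAddCommGroup K) (_ : InnerProductSpace ℂ K) (_ : CompleteSpace K)
      (_ : NormedAddCommGroup H) (_ : InnerProductSpace ℂ H) (_ : CompleteSpace H),
      Nonempty (NormalEmbedding C Z K H)

/-- A subspace `W` of `B(K, H)`, where `H` and `K` are Hilbert `C`-modules through `π` and `σ`, is a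
strong central `C`-bimodule: it is a norm closed central sub-bimodule, and it contains the weak*
sum `∑ j, p j • z j` for every bounded family `z` in `W` and every orthogonal family of projections
`p` in `C`. -/
structure IsStrong {C : VonNeumannAlgebra H₀} {K H : Type u}
    [NormedAddCommGroup K] [InnerProductSpace ℂ K] [CompleteSpace K]
    [NormedAddCommGroup H] [InnerProductSpace ℂ H] [CompleteSpace H]
    (π : C.toStarSubalgebra →⋆ₐ[ℂ] (H →L[ℂ] H)) (σ : C.toStarSubalgebra →⋆ₐ[ℂ] (K →L[ℂ] K))
    (W : Submodule ℂ (K →L[ℂ] H)) : Prop where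
  isClosed : IsClosed (W : Set (K →L[ℂ] H))
  smul_mem : ∀ (c : C.toStarSubalgebra), ∀ T ∈ W, π c ∘L T ∈ W
  central : ∀ (c : C.toStarSubalgebra), ∀ T ∈ W, π c ∘L T = T ∘L σ c
  sum_mem : ∀ (J : Type u) (p : J → C.toStarSubalgebra) (z : J → K →L[ℂ] H),
    (∀ j, IsStarProjection (p j)) → (Pairwise fun i j => p i * p j = 0) →
    (∀ j, z j ∈ W) → (∃ M : ℝ, ∀ j, ‖z j‖ ≤ M) →
    ∀ T : K →L[ℂ] H, HasWeakStarSum (fun j => π (p j) ∘L z j) T → T ∈ W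

/-- The smallest strong bimodule in `B(K, H)` that contains the embedded bimodule `Z`. -/
def NormalEmbedding.strongHull {C : VonNeumannAlgebra H₀} {Z K H : Type u}
    [NormedAddCommGroup Z] [NormedSpace ℂ Z] [Module C.toStarSubalgebra Z]
    [NormedAddCommGroup K] [InnerProductSpace ℂ K] [CompleteSpace K]
    [NormedAddCommGroup H] [InnerProductSpace ℂ H] [CompleteSpace H]
    (E : NormalEmbedding C Z K H) : Submodule ℂ (K →L[ℂ] H) :=
  sInf {W | IsStrong E.left E.right W ∧ ∀ z, E.emb z ∈ W}

theorem isClosed_carrier (C : VonNeumannAlgebra H₀) :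
    IsClosed (C.toStarSubalgebra : Set (H₀ →L[ℂ] H₀)) := by
  have h := C.centralizer_centralizer
  rw [VonNeumannAlgebra.coe_toStarSubalgebra, ← h]
  exact Set.isClosed_centralizer _

theorem norm_rep_le {C : VonNeumannAlgebra H₀} {H : Type u}
    [NormedAddCommGroup H] [InnerProductSpace ℂ H] [CompleteSpace H]
    (π : C.toStarSubalgebra →⋆ₐ[ℂ] (H →L[ℂ] H)) (c : C.toStarSubalgebra) : ‖π c‖ ≤ ‖c‖ := by
  have := isClosed_carrier C
  let _ : CStarAlgebra C.toStarSubalgebra := StarSubalgebra.cstarAlgebra C.toStarSubalgebra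
  exact NonUnitalStarAlgHom.norm_apply_le π c

theorem IsCNRM.norm_smul_le {C : VonNeumannAlgebra H₀} {Z : Type u}
    [NormedAddCommGroup Z] [NormedSpace ℂ Z] [Module C.toStarSubalgebra Z]
    (hZ : IsCNRM C Z) (c : C.toStarSubalgebra) (z : Z) : ‖c • z‖ ≤ ‖c‖ * ‖z‖ := by
  obtain ⟨-, K, H, _, _, _, _, _, _, ⟨E⟩⟩ := hZ
  rw [← E.emb.norm_map, E.emb_left, ← E.emb.norm_map z]
  exact (ContinuousLinearMap.opNorm_comp_le _ _).trans
    (mul_le_mul_of_nonneg_right (norm_rep_le E.left c) (norm_nonneg _))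

theorem IsCNRM.algebraMap_smul {C : VonNeumannAlgebra H₀} {Z : Type u}
    [NormedAddCommGroup Z] [NormedSpace ℂ Z] [Module C.toStarSubalgebra Z]
    (hZ : IsCNRM C Z) (a : ℂ) (z : Z) : algebraMap ℂ C.toStarSubalgebra a • z = a • z := by
  obtain ⟨-, K, H, _, _, _, _, _, _, ⟨E⟩⟩ := hZ
  apply E.emb.injective
  rw [E.emb_left, AlgHomClass.commutes, map_smul]
  ext ξ
  simp [Algebra.algebraMap_eq_smul_one]

end Bimodules

section Tensor

variable {H₀ : Type u} [NormedAddCommGroup H₀] [InnerProductSpace ℂ H₀] [CompleteSpace H₀]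
  (C : VonNeumannAlgebra H₀) [IsMulCommutative C.toStarSubalgebra]
  (X Y : Type u)
  [NormedAddCommGroup X] [NormedSpace ℂ X] [Module C.toStarSubalgebra X]
  [IsScalarTower ℂ C.toStarSubalgebra X]
  [NormedAddCommGroup Y] [NormedSpace ℂ Y] [Module C.toStarSubalgebra Y]
  [IsScalarTower ℂ C.toStarSubalgebra Y]

/-- The algebraic tensor product `X ⊗_C Y`. -/
def AlgTensor : Type u := X ⊗[C.toStarSubalgebra] Y

instance : AddCommGroup (AlgTensor C X Y) :=
  inferInstanceAs (AddCommGroup (X ⊗[C.toStarSubalgebra] Y))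

instance : Module C.toStarSubalgebra (AlgTensor C X Y) :=
  inferInstanceAs (Module C.toStarSubalgebra (X ⊗[C.toStarSubalgebra] Y))

instance : Module ℂ (AlgTensor C X Y) :=
  inferInstanceAs (Module ℂ (X ⊗[C.toStarSubalgebra] Y))

instance : IsScalarTower ℂ C.toStarSubalgebra (AlgTensor C X Y) :=
  inferInstanceAs (IsScalarTower ℂ C.toStarSubalgebra (X ⊗[C.toStarSubalgebra] Y))

variable {X Y}

/-- All the numbers `‖φ(w)‖`, where `φ` is a `C`-bilinear contraction from `X × Y` into a central
normal representable `C`-bimodule `Z`.  (As `X` and `Y` are central, a `C`-bilinear map into any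
normal representable `C`-bimodule has its values in the central part of that bimodule.) -/
def nuSet (w : AlgTensor C X Y) : Set ℝ :=
  {r | ∃ (Z : Type u) (_ : NormedAddCommGroup Z) (_ : NormedSpace ℂ Z)
      (_ : Module C.toStarSubalgebra Z)
      (φ : X →ₗ[C.toStarSubalgebra] Y →ₗ[C.toStarSubalgebra] Z),
      IsCNRM C Z ∧ (∀ x y, ‖φ x y‖ ≤ ‖x‖ * ‖y‖) ∧ r = ‖TensorProduct.lift φ w‖}

/-- The norm `ν_C` on `X ⊗_C Y`. -/
def nu (w : AlgTensor C X Y) : ℝ := sSup (nuSet C w)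

theorem nuSet_nonneg (w : AlgTensor C X Y) : ∀ r ∈ nuSet C w, 0 ≤ r := by
  rintro r ⟨Z, _, _, _, φ, -, -, rfl⟩
  exact norm_nonneg _

theorem nu_nonneg (w : AlgTensor C X Y) : 0 ≤ nu C w := Real.sSup_nonneg (nuSet_nonneg C w)

theorem nuSet_bddAbove (w : AlgTensor C X Y) : BddAbove (nuSet C w) := by
  induction w using TensorProduct.induction_on with
  | zero =>
    refine ⟨0, ?_⟩
    rintro r ⟨Z, _, _, _, φ, -, -, rfl⟩
    exact le_of_eq ((congrArg norm (map_zero (TensorProduct.lift φ))).trans norm_zero)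
  | tmul x y =>
    refine ⟨‖x‖ * ‖y‖, ?_⟩
    rintro r ⟨Z, _, _, _, φ, -, h, rfl⟩
    rw [TensorProduct.lift.tmul]
    exact h x y
  | add a b ha hb =>
    obtain ⟨A, hA⟩ := ha
    obtain ⟨B, hB⟩ := hb
    refine ⟨A + B, ?_⟩
    rintro r ⟨Z, _, _, _, φ, hZ, h, rfl⟩
    rw [map_add]
    exact (norm_add_le _ _).trans
      (add_le_add (hA ⟨Z, _, _, _, φ, hZ, h, rfl⟩) (hB ⟨Z, _, _, _, φ, hZ, h, rfl⟩))

theorem nu_add_le (v w : AlgTensor C X Y) : nu C (v + w) ≤ nu C v + nu C w := by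
  refine Real.sSup_le ?_ (add_nonneg (nu_nonneg C v) (nu_nonneg C w))
  rintro r ⟨Z, _, _, _, φ, hZ, h, rfl⟩
  have e : TensorProduct.lift φ (v + w) = TensorProduct.lift φ v + TensorProduct.lift φ w :=
    map_add (TensorProduct.lift φ) v w
  rw [e]
  exact (norm_add_le _ _).trans
    (add_le_add (le_csSup (nuSet_bddAbove C v) ⟨Z, _, _, _, φ, hZ, h, rfl⟩)
      (le_csSup (nuSet_bddAbove C w) ⟨Z, _, _, _, φ, hZ, h, rfl⟩))

theorem nu_smul_le (c : C.toStarSubalgebra) (w : AlgTensor C X Y) :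
    nu C (c • w) ≤ ‖c‖ * nu C w := by
  refine Real.sSup_le ?_ (mul_nonneg (norm_nonneg c) (nu_nonneg C w))
  rintro r ⟨Z, _, _, _, φ, hZ, h, rfl⟩
  have e : TensorProduct.lift φ (c • w) = c • TensorProduct.lift φ w :=
    map_smul (TensorProduct.lift φ) c w
  rw [e]
  exact (hZ.norm_smul_le c _).trans (mul_le_mul_of_nonneg_left
    (le_csSup (nuSet_bddAbove C w) ⟨Z, _, _, _, φ, hZ, h, rfl⟩) (norm_nonneg c))

theorem nu_complex_smul_le (a : ℂ) (w : AlgTensor C X Y) : nu C (a • w) ≤ ‖a‖ * nu C w := by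
  refine Real.sSup_le ?_ (mul_nonneg (norm_nonneg a) (nu_nonneg C w))
  rintro r ⟨Z, _, _, _, φ, hZ, h, rfl⟩
  have e : TensorProduct.lift φ (a • w) = a • TensorProduct.lift φ w := by
    rw [← IsScalarTower.algebraMap_smul C.toStarSubalgebra a w]
    exact (map_smul (TensorProduct.lift φ) _ w).trans (hZ.algebraMap_smul a _)
  rw [e, norm_smul]
  exact mul_le_mul_of_nonneg_left
    (le_csSup (nuSet_bddAbove C w) ⟨Z, _, _, _, φ, hZ, h, rfl⟩) (norm_nonneg a)

theorem nu_zero : nu C (0 : AlgTensor C X Y) = 0 := by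
  refine le_antisymm ?_ (nu_nonneg C _)
  simpa using nu_complex_smul_le C 0 (0 : AlgTensor C X Y)

theorem nu_neg (w : AlgTensor C X Y) : nu C (-w) = nu C w := by
  have h : ∀ v : AlgTensor C X Y, nu C (-v) ≤ nu C v := fun v => by
    simpa using nu_complex_smul_le C (-1) v
  refine le_antisymm (h w) ?_
  simpa using h (-w)

variable (X Y)

instance : SeminormedAddCommGroup (AlgTensor C X Y) :=
  AddGroupSeminorm.toSeminormedAddCommGroup
    { toFun := nu C
      map_zero' := nu_zero C
      add_le' := nu_add_le C
      neg' := nu_neg C }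

instance : NormedSpace ℂ (AlgTensor C X Y) where
  norm_smul_le := nu_complex_smul_le C

instance : UniformContinuousConstSMul C.toStarSubalgebra (AlgTensor C X Y) where
  uniformContinuous_const_smul c :=
    (AddMonoidHomClass.lipschitz_of_bound
      (DistribSMul.toAddMonoidHom (AlgTensor C X Y) c) ‖c‖ (nu_smul_le C c)).uniformContinuous

/-- The normal projective tensor product: the completion of `X ⊗_C Y` in the norm `ν_C`. -/
abbrev NuTensor : Type u := UniformSpace.Completion (AlgTensor C X Y)

variable {X Y}

/-- The elementary tensor `x ⊗_C y` in the normal projective tensor product. -/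
def nuTmul (x : X) (y : Y) : NuTensor C X Y :=
  ((show AlgTensor C X Y from x ⊗ₜ[C.toStarSubalgebra] y : AlgTensor C X Y) : NuTensor C X Y)

/-- `w = ∑ j, c j • (x j ⊗ y j)` (weak* convergent in the `B(K, H)` in which the normal projective
tensor product is embedded), where `x j`, `y j` are in the closed unit balls, `c j` are positive
elements of `C`, and `∑ j, c j = s` (weak* convergent). -/
structure IsRepresentation {K H : Type u}
    [NormedAddCommGroup K] [InnerProductSpace ℂ K] [CompleteSpace K]
    [NormedAddCommGroup H] [InnerProductSpace ℂ H] [CompleteSpace H]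
    (E : NormalEmbedding C (NuTensor C X Y) K H) (w : K →L[ℂ] H) {J : Type u}
    (c : J → C.toStarSubalgebra) (x : J → X) (y : J → Y) (s : C.toStarSubalgebra) : Prop where
  nonneg : ∀ j, 0 ≤ c j
  norm_left_le : ∀ j, ‖x j‖ ≤ 1
  norm_right_le : ∀ j, ‖y j‖ ≤ 1
  hasSum_coeff : HasWeakStarSum (fun j => (c j : H₀ →L[ℂ] H₀)) (s : H₀ →L[ℂ] H₀)
  hasSum : HasWeakStarSum (fun j => E.emb (c j • nuTmul C (x j) (y j))) w

end Tensor

end CNRM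

end

open CNRM

/-!
Write `v ∈ X ⊗_C Y` as a finite sum of terms `c • (x ⊗ y)` with `c ≥ 0` and call
`s = ∑ (‖x‖ * ‖y‖) • c` the total coefficient of this decomposition. For a vector `ξ`, the infimum
of `⟪ξ, s ξ⟫` over all decompositions is a seminorm in `v`. A Hahn–Banach functional for it is, by a
Radon–Nikodym argument, the composition of the vector functional of `ξ` with a `C`-linear map into
the commutant of `C` that comes from a `C`-bilinear contraction, so the infimum is at most
`ν_C(v) * ‖ξ‖ ^ 2`. A spectral projection of `r - s` therefore shows that, for `r > ν_C(v)`, every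
nonzero projection of `C` dominates a nonzero projection `p` such that `p * s ≤ r • p` for some
decomposition.

The smallest strong bimodule consists of operators that are norm limits of elements of `X ⊗_C Y`
after cutting down by suitable projections of `C`. Gluing decompositions along a maximal orthogonal
family of such projections approximates `w` in norm by represented operators with
`‖s‖ ≤ ‖w‖ + ε`, and summing the successive errors represents `w` itself.
-/

noncomputable section

namespace CNRM

open Filter Topology
open scoped InnerProductSpace

/- Without these shortcuts every search for the ring structure of `C` first looks, at length, for a
commutative multiplication on all operators. -/

local instance {H : Type*} [NormedAddCommGroup H] [InnerProductSpace ℂ H] [CompleteSpace H]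
    (C : VonNeumannAlgebra H) : Semiring C.toStarSubalgebra :=
  Ring.toSemiring

local instance {H : Type*} [NormedAddCommGroup H] [InnerProductSpace ℂ H] [CompleteSpace H]
    (C : VonNeumannAlgebra H) : Mul C.toStarSubalgebra :=
  Distrib.toMul

section WeakLimits

variable {K H : Type*} [NormedAddCommGroup K] [InnerProductSpace ℂ K]
  [NormedAddCommGroup H] [InnerProductSpace ℂ H]

/-- The vector functional `T ↦ re ⟪ξ, T ξ⟫`. -/
def vecForm (ξ : H) : (H →L[ℂ] H) →ₗ[ℝ] ℝ where
  toFun T := (⟪ξ, T ξ⟫_ℂ).re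
  map_add' S T := by simp
  map_smul' r T := by simp [inner_smul_right_eq_smul]

theorem vecForm_apply (ξ : H) (T : H →L[ℂ] H) : vecForm ξ T = (⟪ξ, T ξ⟫_ℂ).re := rfl

theorem vecForm_one (ξ : H) : vecForm ξ 1 = ‖ξ‖ ^ 2 := by
  rw [vecForm_apply, one_apply_eq_self, inner_self_eq_norm_sq_to_K]
  norm_cast

theorem vecForm_le_norm (ξ : H) (T : H →L[ℂ] H) : vecForm ξ T ≤ ‖T‖ * ‖ξ‖ ^ 2 :=
  calc vecForm ξ T ≤ ‖ξ‖ * ‖T ξ‖ := re_inner_le_norm (𝕜 := ℂ) ξ (T ξ)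
    _ ≤ ‖ξ‖ * (‖T‖ * ‖ξ‖) := by gcongr; exact T.le_opNorm ξ
    _ = ‖T‖ * ‖ξ‖ ^ 2 := by ring

theorem vecForm_mono (ξ : H) : Monotone (vecForm ξ) := fun S T h => by
  have := (ContinuousLinearMap.le_def S T |>.1 h).re_inner_nonneg_right ξ
  rwa [← sub_nonneg, ← map_sub]

theorem vecForm_nonneg (ξ : H) {T : H →L[ℂ] H} (hT : 0 ≤ T) : 0 ≤ vecForm ξ T := by
  simpa using vecForm_mono ξ hT

theorem le_of_vecForm_le [CompleteSpace H] {S T : H →L[ℂ] H} (hST : IsSelfAdjoint (T - S))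
    (h : ∀ ξ, vecForm ξ S ≤ vecForm ξ T) : S ≤ T := by
  rw [ContinuousLinearMap.le_def, ContinuousLinearMap.isPositive_def']
  refine ⟨hST, fun ξ => ?_⟩
  rw [ContinuousLinearMap.reApplyInnerSelf_apply, inner_re_symm]
  exact (sub_nonneg.2 (h ξ)).trans_eq (map_sub (vecForm ξ) T S).symm

/-- Convergence in the weak operator topology. -/
def TendstoWeak {ι : Type*} (f : ι → K →L[ℂ] H) (l : Filter ι) (T : K →L[ℂ] H) : Prop :=
  ∀ (η : H) (ξ : K), Tendsto (fun i => ⟪η, f i ξ⟫_ℂ) l (𝓝 ⟪η, T ξ⟫_ℂ)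

theorem TendstoWeak.vecForm {ι : Type*} {l : Filter ι} {f : ι → H →L[ℂ] H} {T : H →L[ℂ] H}
    (h : TendstoWeak f l T) (ξ : H) :
    Tendsto (fun i => vecForm ξ (f i)) l (𝓝 (vecForm ξ T)) :=
  (Complex.continuous_re.tendsto _).comp (h ξ ξ)

theorem TendstoWeak.mul_eq_mul [CompleteSpace H] {ι : Type*} {l : Filter ι} [l.NeBot]
    {f : ι → H →L[ℂ] H} {R T : H →L[ℂ] H} (h : TendstoWeak f l T) (hR : ∀ i, R * f i = f i * R) :
    R * T = T * R := by
  refine ContinuousLinearMap.ext fun ξ => ext_inner_left ℂ fun η => ?_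
  have h₁ := h (ContinuousLinearMap.adjoint R η) ξ
  simp only [ContinuousLinearMap.adjoint_inner_left] at h₁
  exact tendsto_nhds_unique h₁ <|
    (h η (R ξ)).congr fun i => congrArg (fun A : H →L[ℂ] H => ⟪η, A ξ⟫_ℂ) (hR i).symm

theorem TendstoWeak.isSelfAdjoint [CompleteSpace H] {ι : Type*} {l : Filter ι} [l.NeBot]
    {f : ι → H →L[ℂ] H} {T : H →L[ℂ] H} (h : TendstoWeak f l T) (hf : ∀ i, IsSelfAdjoint (f i)) :
    IsSelfAdjoint T := by
  rw [ContinuousLinearMap.isSelfAdjoint_iff_isSymmetric]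
  intro η ξ
  have h₁ := (Complex.continuous_conj.tendsto _).comp (h ξ η)
  simp only [Function.comp_def, inner_conj_symm] at h₁
  exact tendsto_nhds_unique h₁ ((h η ξ).congr fun i => ((hf i).isSymmetric η ξ).symm)

variable [CompleteSpace K] [CompleteSpace H]

theorem exists_clm_of_form (B : H →ₗ⋆[ℂ] K →ₗ[ℂ] ℂ) {M : ℝ} (hM : 0 ≤ M)
    (hB : ∀ η ξ, ‖B η ξ‖ ≤ M * ‖η‖ * ‖ξ‖) :
    ∃ T : K →L[ℂ] H, ‖T‖ ≤ M ∧ ∀ η ξ, ⟪η, T ξ⟫_ℂ = B η ξ := by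
  let S : H →L[ℂ] K := ((InnerProductSpace.toDual ℂ K).symm.toContinuousLinearEquiv :
    StrongDual ℂ K →L⋆[ℂ] K) ∘SL B.mkContinuous₂ M hB
  have hS : ∀ η ξ, ⟪S η, ξ⟫_ℂ = B η ξ := fun η ξ => InnerProductSpace.toDual_symm_apply
  refine ⟨ContinuousLinearMap.adjoint S, ?_, fun η ξ => ?_⟩
  · rw [LinearIsometryEquiv.norm_map]
    refine S.opNorm_le_bound hM fun η => ?_
    calc ‖S η‖ = ‖B.mkContinuous₂ M hB η‖ := (InnerProductSpace.toDual ℂ K).symm.norm_map _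
      _ ≤ M * ‖η‖ := (B.mkContinuous₂ M hB).le_of_opNorm_le
        (B.mkContinuous₂_norm_le hM hB) η
  · rw [ContinuousLinearMap.adjoint_inner_right, hS]

theorem exists_tendstoWeak {ι : Type*} {l : Filter ι} [l.NeBot] {f : ι → K →L[ℂ] H} {M : ℝ}
    (hM : ∀ᶠ i in l, ‖f i‖ ≤ M) (hf : ∀ η ξ, ∃ z, Tendsto (fun i => ⟪η, f i ξ⟫_ℂ) l (𝓝 z)) :
    ∃ T : K →L[ℂ] H, ‖T‖ ≤ M ∧ TendstoWeak f l T := by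
  have hM0 : 0 ≤ M := let ⟨i, hi⟩ := hM.exists; (norm_nonneg (f i)).trans hi
  choose b hb using hf
  let B : H →ₗ⋆[ℂ] K →ₗ[ℂ] ℂ := LinearMap.mk₂'ₛₗ (starRingEnd ℂ) (RingHom.id ℂ) b
    (fun η η' ξ => tendsto_nhds_unique (hb (η + η') ξ)
      (by simpa only [inner_add_left] using (hb η ξ).add (hb η' ξ)))
    (fun c η ξ => tendsto_nhds_unique (hb (c • η) ξ)
      (by simpa only [inner_smul_left, smul_eq_mul] using (hb η ξ).const_mul _))
    (fun η ξ ξ' => tendsto_nhds_unique (hb η (ξ + ξ'))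
      (by simpa only [map_add, inner_add_right] using (hb η ξ).add (hb η ξ')))
    (fun c η ξ => tendsto_nhds_unique (hb η (c • ξ))
      (by simpa only [map_smul, inner_smul_right, smul_eq_mul, RingHom.id_apply]
        using (hb η ξ).const_mul _))
  obtain ⟨T, hT, hTB⟩ := exists_clm_of_form B hM0 fun η ξ => le_of_tendsto (hb η ξ).norm <| by
    filter_upwards [hM] with i hi
    calc ‖⟪η, f i ξ⟫_ℂ‖ ≤ ‖η‖ * ‖f i ξ‖ := norm_inner_le_norm _ _
      _ ≤ ‖η‖ * (M * ‖ξ‖) := by gcongr; exact (f i).le_of_opNorm_le hi ξ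
      _ = M * ‖η‖ * ‖ξ‖ := by ring
  exact ⟨T, hT, fun η ξ => hTB η ξ ▸ hb η ξ⟩

theorem exists_tendstoWeak_of_vecForm {ι : Type*} {l : Filter ι} [l.NeBot] {f : ι → H →L[ℂ] H}
    {M : ℝ} (hM : ∀ᶠ i in l, ‖f i‖ ≤ M) (hsa : ∀ i, IsSelfAdjoint (f i))
    (hf : ∀ ξ, ∃ r, Tendsto (fun i => vecForm ξ (f i)) l (𝓝 r)) :
    ∃ T : H →L[ℂ] H, TendstoWeak f l T := by
  choose r hr using hf
  have hdiag : ∀ ξ, Tendsto (fun i => ⟪f i ξ, ξ⟫_ℂ) l (𝓝 (r ξ)) := fun ξ => by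
    refine ((Complex.continuous_ofReal.tendsto _).comp (hr ξ)).congr fun i => ?_
    have hsymm : ⟪f i ξ, ξ⟫_ℂ = ⟪ξ, f i ξ⟫_ℂ := (hsa i).isSymmetric ξ ξ
    rw [Function.comp_apply, vecForm_apply, ← hsymm]
    exact (hsa i).isSymmetric.coe_re_inner_apply_self ξ
  obtain ⟨T, -, hT⟩ := exists_tendstoWeak hM fun η ξ =>
    ⟨_, (((((hdiag (η + ξ)).sub (hdiag (η - ξ))).sub
      ((hdiag (η + Complex.I • ξ)).const_mul Complex.I)).add
      ((hdiag (η - Complex.I • ξ)).const_mul Complex.I)).div_const 4).congr fun i =>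
        (inner_map_polarization' (f i : H →ₗ[ℂ] H) η ξ).symm.trans ((hsa i).isSymmetric η ξ)⟩
  exact ⟨T, hT⟩

section MonotoneNets

variable {ι : Type*} [Preorder ι] [IsDirectedOrder ι] [Nonempty ι] {f : ι → H →L[ℂ] H}

theorem isLUB_of_tendsto_vecForm (hf : Monotone f) {T : H →L[ℂ] H}
    (hT : ∀ i, IsSelfAdjoint (T - f i))
    (h : ∀ ξ, Tendsto (fun i => vecForm ξ (f i)) atTop (𝓝 (vecForm ξ T))) :
    IsLUB (Set.range f) T := by
  have hle : ∀ i, f i ≤ T := fun i => le_of_vecForm_le (hT i) fun ξ =>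
    ((vecForm_mono ξ).comp hf).ge_of_tendsto (h ξ) i
  refine ⟨Set.forall_mem_range.2 hle, fun b hb => ?_⟩
  have hb : ∀ i, f i ≤ b := Set.forall_mem_range.1 hb
  obtain ⟨i₀⟩ := ‹Nonempty ι›
  refine le_of_vecForm_le ?_ fun ξ => le_of_tendsto' (h ξ) fun i => vecForm_mono ξ (hb i)
  rw [← sub_sub_sub_cancel_right b T (f i₀)]
  exact (IsSelfAdjoint.of_nonneg (sub_nonneg.2 (hb i₀))).sub (hT i₀)

theorem exists_isLUB_tendstoWeak (hf : Monotone f) {b : H →L[ℂ] H} (hb : ∀ i, f i ≤ b) :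
    ∃ T : H →L[ℂ] H, IsLUB (Set.range f) T ∧ TendstoWeak f atTop T := by
  have hsa : ∀ i, IsSelfAdjoint (b - f i) := fun i => .of_nonneg (sub_nonneg.2 (hb i))
  obtain ⟨i₀⟩ := id ‹Nonempty ι›
  have hM : ∀ᶠ i in atTop, ‖b - f i‖ ≤ ‖b - f i₀‖ := by
    filter_upwards [eventually_ge_atTop i₀] with i hi
    exact CStarAlgebra.norm_le_norm_of_nonneg_of_le (sub_nonneg.2 (hb i))
      (sub_le_sub_left (hf hi) b)
  obtain ⟨R, hR⟩ := exists_tendstoWeak_of_vecForm hM hsa fun ξ =>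
    ⟨_, tendsto_atTop_ciInf (fun i j hij => vecForm_mono ξ (sub_le_sub_left (hf hij) b))
      ⟨0, Set.forall_mem_range.2 fun i => vecForm_nonneg ξ (sub_nonneg.2 (hb i))⟩⟩
  have hT : TendstoWeak f atTop (b - R) := fun η ξ => by
    simpa [inner_sub_right] using (hR η ξ).const_sub ⟪η, b ξ⟫_ℂ
  refine ⟨b - R, isLUB_of_tendsto_vecForm hf (fun i => ?_) hT.vecForm, hT⟩
  rw [sub_right_comm]
  exact (hsa i).sub (hR.isSelfAdjoint hsa)

end MonotoneNets

end WeakLimits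

section VonNeumannAlgebra

variable {H₀ : Type u} [NormedAddCommGroup H₀] [InnerProductSpace ℂ H₀] [CompleteSpace H₀]
  {C : VonNeumannAlgebra H₀}
  {H : Type u} [NormedAddCommGroup H] [InnerProductSpace ℂ H] [CompleteSpace H]
  {π : C.toStarSubalgebra →⋆ₐ[ℂ] (H →L[ℂ] H)}

theorem mem_of_forall_mul_eq_mul {T : H₀ →L[ℂ] H₀}
    (h : ∀ R : H₀ →L[ℂ] H₀, (∀ c : C.toStarSubalgebra, R * c = c * R) → R * T = T * R) :
    T ∈ C.toStarSubalgebra := by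
  rw [VonNeumannAlgebra.mem_carrier, ← C.centralizer_centralizer]
  exact fun R hR => h R fun c => (hR c c.2).symm

instance : CStarAlgebra C.toStarSubalgebra where
  toNormedAlgebra :=
    { toAlgebra := C.toStarSubalgebra.algebra
      norm_smul_le := fun a x => norm_smul_le a (x : H₀ →L[ℂ] H₀) }
  toCompleteSpace := (isClosed_carrier C).completeSpace_coe
  norm_mul_self_le x := (CStarRing.norm_star_mul_self (x := (x : H₀ →L[ℂ] H₀))).symm.le
  star_smul a x := star_smul a x

theorem sqrt_mem {c : H₀ →L[ℂ] H₀} (hc : c ∈ C.toStarSubalgebra) :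
    CFC.sqrt c ∈ C.toStarSubalgebra :=
  mem_of_forall_mul_eq_mul fun R hR =>
    (Commute.cfcₙ_nnreal (hR ⟨c, hc⟩ : Commute R c).symm NNReal.sqrt).symm

instance : StarOrderedRing C.toStarSubalgebra :=
  .of_nonneg_iff' (fun h z => add_le_add_right (α := H₀ →L[ℂ] H₀) h z) fun c => by
    refine ⟨fun hc => ⟨⟨CFC.sqrt (c : H₀ →L[ℂ] H₀), sqrt_mem c.2⟩, Subtype.ext ?_⟩, ?_⟩
    · have h := (CFC.sqrt_nonneg (c : H₀ →L[ℂ] H₀)).isSelfAdjoint.star_eq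
      exact ((congrArg (· * CFC.sqrt (c : H₀ →L[ℂ] H₀)) h).trans
        (CFC.sqrt_mul_sqrt_self (c : H₀ →L[ℂ] H₀) hc)).symm
    · rintro ⟨s, rfl⟩
      exact star_mul_self_nonneg (s : H₀ →L[ℂ] H₀)

theorem exists_isLUB_tendstoWeak_coe {ι : Type*} [Preorder ι] [IsDirectedOrder ι] [Nonempty ι]
    {f : ι → C.toStarSubalgebra} (hf : Monotone f) {b : C.toStarSubalgebra} (hb : ∀ i, f i ≤ b) :
    ∃ s : C.toStarSubalgebra, IsLUB (Set.range f) s ∧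
      TendstoWeak (fun i => (f i : H₀ →L[ℂ] H₀)) atTop (s : H₀ →L[ℂ] H₀) := by
  obtain ⟨T, hlub, hT⟩ := exists_isLUB_tendstoWeak (f := fun i => (f i : H₀ →L[ℂ] H₀))
    (fun _ _ hij => hf hij) hb
  have hmem : T ∈ C.toStarSubalgebra :=
    mem_of_forall_mul_eq_mul fun R hR => hT.mul_eq_mul fun i => hR (f i)
  refine ⟨⟨T, hmem⟩, ⟨Set.forall_mem_range.2 fun i => hlub.1 ⟨i, rfl⟩, fun c hc => ?_⟩, hT⟩
  exact hlub.2 (Set.forall_mem_range.2 fun i => hc ⟨i, rfl⟩)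

theorem IsNormal.tendstoWeak (hπ : IsNormal C π) {ι : Type*} [Preorder ι] [IsDirectedOrder ι]
    [Nonempty ι] {f : ι → C.toStarSubalgebra} (hf : Monotone f) {s : C.toStarSubalgebra}
    (hs : IsLUB (Set.range f) s) : TendstoWeak (fun i => π (f i)) atTop (π s) := by
  have hlub := hπ _ _ (Set.range_nonempty f) hf.directed_le.directedOn_range hs
  rw [← Set.range_comp] at hlub
  have hmono : Monotone (π ∘ f) := (OrderHomClass.mono π).comp hf
  obtain ⟨T, hT, hlim⟩ := exists_isLUB_tendstoWeak hmono fun i => hlub.1 ⟨i, rfl⟩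
  rwa [hlub.unique hT]

theorem isNormal_of_tendsto_vecForm
    (h : ∀ (ι : Type u) [Preorder ι] [IsDirectedOrder ι] [Nonempty ι] (f : ι → C.toStarSubalgebra)
      (s : C.toStarSubalgebra), Monotone f → IsLUB (Set.range f) s →
        ∀ ξ, Tendsto (fun i => vecForm ξ (π (f i))) atTop (𝓝 (vecForm ξ (π s)))) :
    IsNormal C π := by
  intro S s hne hdir hs
  have := hne.to_subtype
  have := hdir.isDirectedOrder
  rw [Set.image_eq_range]
  refine isLUB_of_tendsto_vecForm (f := fun i : S => π i)
    (fun i j hij => OrderHomClass.mono π hij) (fun i => ?_)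
    (h S _ s (Subtype.mono_coe S) (by rwa [Subtype.range_coe]))
  exact .of_nonneg (sub_nonneg.2 (OrderHomClass.mono π (hs.1 i.2)))

theorem isNormal_subtype (C : VonNeumannAlgebra H₀) : IsNormal C C.toStarSubalgebra.subtype :=
  isNormal_of_tendsto_vecForm fun ι _ _ _ f s hf hs ξ => by
    obtain ⟨t, ht, hlim⟩ := exists_isLUB_tendstoWeak_coe hf fun i => hs.1 ⟨i, rfl⟩
    rw [hs.unique ht]
    exact hlim.vecForm ξ

end VonNeumannAlgebra

section WeakStarSums

variable {J : Type u} {K H : Type u} [NormedAddCommGroup K] [InnerProductSpace ℂ K]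
  [NormedAddCommGroup H] [InnerProductSpace ℂ H]
  {f : J → K →L[ℂ] H} {T : K →L[ℂ] H}

theorem tendstoWeak_sum_iff : TendstoWeak (fun F : Finset J => ∑ j ∈ F, f j) atTop T ↔
    ∀ η ξ, HasSum (fun j => ⟪η, f j ξ⟫_ℂ) ⟪η, T ξ⟫_ℂ := by
  simp only [TendstoWeak, HasSum, SummationFilter.unconditional_filter,
    sum_apply, inner_sum]

theorem HasWeakStarSum.tendstoWeak (h : HasWeakStarSum f T) :
    TendstoWeak (fun F : Finset J => ∑ j ∈ F, f j) atTop T := by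
  refine tendstoWeak_sum_iff.2 fun η ξ => ?_
  have hsupp : ∀ S : K →L[ℂ] H,
      ∑' n : ℕ, ⟪(Pi.single 0 η : ℕ → H) n, S ((Pi.single 0 ξ : ℕ → K) n)⟫_ℂ = ⟪η, S ξ⟫_ℂ :=
    fun S => (tsum_eq_single 0 fun n hn => by simp [hn]).trans (by simp)
  simpa only [hsupp] using h (Pi.single 0 ξ) (Pi.single 0 η)
    (summable_of_ne_finset_zero (s := {0}) fun n hn => by simp_all)
    (summable_of_ne_finset_zero (s := {0}) fun n hn => by simp_all)

theorem HasWeakStarSum.hasSum_vecForm {f : J → H →L[ℂ] H} {T : H →L[ℂ] H}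
    (h : HasWeakStarSum f T) (ξ : H) : HasSum (fun j => vecForm ξ (f j)) (vecForm ξ T) :=
  Complex.hasSum_re (tendstoWeak_sum_iff.1 h.tendstoWeak ξ ξ)

theorem HasWeakStarSum.unique {S : K →L[ℂ] H} (hS : HasWeakStarSum f S)
    (hT : HasWeakStarSum f T) : S = T :=
  ContinuousLinearMap.ext fun ξ => ext_inner_left ℂ fun η =>
    tendsto_nhds_unique (hS.tendstoWeak η ξ) (hT.tendstoWeak η ξ)

theorem HasWeakStarSum.comp_left [CompleteSpace H] {L : Type u} [NormedAddCommGroup L]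
    [InnerProductSpace ℂ L] [CompleteSpace L] (h : HasWeakStarSum f T) (R : H →L[ℂ] L) :
    HasWeakStarSum (fun j => R ∘L f j) (R ∘L T) := by
  intro ξ η hξ hη
  have hRη : Summable fun n => ‖ContinuousLinearMap.adjoint R (η n)‖ ^ 2 :=
    .of_nonneg_of_le (fun n => by positivity) (fun n => by
      rw [← mul_pow]
      gcongr
      exact (ContinuousLinearMap.adjoint R).le_opNorm (η n)) (hη.mul_left _)
  simpa only [ContinuousLinearMap.adjoint_inner_left, ContinuousLinearMap.comp_apply]
    using h ξ _ hξ hRη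

theorem HasWeakStarSum.sigma {I : Type u} {J : I → Type u} {f : (Σ i, J i) → K →L[ℂ] H}
    {S : I → K →L[ℂ] H} (h : HasWeakStarSum f T)
    (hS : ∀ i, HasWeakStarSum (fun j => f ⟨i, j⟩) (S i)) : HasWeakStarSum S T :=
  fun ξ η hξ hη => (h ξ η hξ hη).sigma fun i => hS i ξ η hξ hη

theorem hasWeakStarSum_of_summable
    (hf : ∀ (ξ : ℕ → K) (η : ℕ → H), Summable (fun n => ‖ξ n‖ ^ 2) →
      Summable (fun n => ‖η n‖ ^ 2) → Summable fun p : J × ℕ => ⟪η p.2, f p.1 (ξ p.2)⟫_ℂ)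
    (hT : TendstoWeak (fun F : Finset J => ∑ j ∈ F, f j) atTop T) : HasWeakStarSum f T := by
  intro ξ η hξ hη
  have hsum := hf ξ η hξ hη
  have hcomm := Summable.tsum_comm (f := fun j n => ⟪η n, f j (ξ n)⟫_ℂ) hsum
  simp only [(tendstoWeak_sum_iff.1 hT _ _).tsum_eq] at hcomm
  rw [hcomm]
  exact hsum.prod.hasSum

theorem hasWeakStarSum_of_summable_norm (hf : Summable fun j => ‖f j‖) (hT : HasSum f T) :
    HasWeakStarSum f T := by
  refine hasWeakStarSum_of_summable (fun ξ η hξ hη => ?_) <| tendstoWeak_sum_iff.2 fun η ξ =>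
    (innerSL ℂ η ∘L ContinuousLinearMap.apply ℂ H ξ).hasSum hT
  refine .of_norm_bounded (hf.mul_of_nonneg (hη.add hξ) (fun j => norm_nonneg _)
    fun n => by positivity) fun p => ?_
  calc ‖⟪η p.2, f p.1 (ξ p.2)⟫_ℂ‖ ≤ ‖η p.2‖ * ‖f p.1 (ξ p.2)‖ := norm_inner_le_norm _ _
    _ ≤ ‖η p.2‖ * (‖f p.1‖ * ‖ξ p.2‖) := by gcongr; exact (f p.1).le_opNorm _
    _ = ‖f p.1‖ * (‖η p.2‖ * ‖ξ p.2‖) := by ring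
    _ ≤ ‖f p.1‖ * (‖η p.2‖ ^ 2 + ‖ξ p.2‖ ^ 2) := by
      gcongr
      nlinarith [sq_nonneg (‖η p.2‖ - ‖ξ p.2‖), sq_nonneg (‖η p.2‖ + ‖ξ p.2‖)]

theorem summable_prod_vecForm {a : J → H →L[ℂ] H} {s : H →L[ℂ] H} (ha : ∀ j, 0 ≤ a j)
    (hs : ∀ η, HasSum (fun j => vecForm η (a j)) (vecForm η s)) {η : ℕ → H}
    (hη : Summable fun n => ‖η n‖ ^ 2) :
    Summable fun p : J × ℕ => vecForm (η p.2) (a p.1) := by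
  have hnonneg : ∀ η j, 0 ≤ vecForm η (a j) := fun η j => vecForm_nonneg η (ha j)
  suffices h : Summable fun p : ℕ × J => vecForm (η p.1) (a p.2) from h.prod_symm
  refine (summable_prod_of_nonneg fun p => hnonneg _ _).2 ⟨fun n => (hs (η n)).summable, ?_⟩
  simp only [(hs _).tsum_eq]
  exact .of_nonneg_of_le (fun n => (hs (η n)).nonneg (hnonneg _))
    (fun n => vecForm_le_norm (η n) s) (hη.mul_left ‖s‖)

theorem opNorm_le_of_norm_inner_le {M : ℝ} (hM : 0 ≤ M)
    (h : ∀ (η : H) (ξ : K), ‖η‖ = 1 → ‖ξ‖ = 1 → ‖⟪η, T ξ⟫_ℂ‖ ≤ M) : ‖T‖ ≤ M := by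
  refine ContinuousLinearMap.opNorm_le_of_unit_norm hM fun ξ hξ => ?_
  obtain h0 | h0 := eq_or_ne (T ξ) 0
  · rwa [h0, norm_zero]
  calc ‖T ξ‖ = ‖⟪((‖T ξ‖ : ℂ)⁻¹ • T ξ : H), T ξ⟫_ℂ‖ := by
        rw [inner_smul_left, inner_self_eq_norm_sq_to_K]
        simp [sq, h0]
    _ ≤ M := h _ ξ (norm_smul_inv_norm h0) hξ

variable [CompleteSpace K] [CompleteSpace H]

theorem exists_hasWeakStarSum {a : J → H →L[ℂ] H} {s : H →L[ℂ] H} {b : J → K →L[ℂ] K}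
    {t : K →L[ℂ] K} (ha : ∀ j, 0 ≤ a j) (hb : ∀ j, 0 ≤ b j)
    (hs : ∀ η, HasSum (fun j => vecForm η (a j)) (vecForm η s))
    (ht : ∀ ξ, HasSum (fun j => vecForm ξ (b j)) (vecForm ξ t))
    (hf : ∀ j η ξ, ‖⟪η, f j ξ⟫_ℂ‖ ≤ (vecForm η (a j) + vecForm ξ (b j)) / 2) :
    ∃ T, ‖T‖ ≤ (‖s‖ + ‖t‖) / 2 ∧ HasWeakStarSum f T := by
  have hbound : ∀ F : Finset J, ‖∑ j ∈ F, f j‖ ≤ (‖s‖ + ‖t‖) / 2 := fun F => by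
    refine opNorm_le_of_norm_inner_le (by positivity) fun η ξ hη hξ => ?_
    rw [sum_apply, inner_sum]
    calc ‖∑ j ∈ F, ⟪η, f j ξ⟫_ℂ‖ ≤ ∑ j ∈ F, (vecForm η (a j) + vecForm ξ (b j)) / 2 :=
          norm_sum_le_of_le F fun j _ => hf j η ξ
      _ ≤ (vecForm η s + vecForm ξ t) / 2 :=
          sum_le_hasSum F (fun j _ => (norm_nonneg _).trans (hf j η ξ))
            (((hs η).add (ht ξ)).div_const 2)
      _ ≤ (‖s‖ + ‖t‖) / 2 := by
          have h₁ := vecForm_le_norm η s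
          have h₂ := vecForm_le_norm ξ t
          rw [hη, one_pow, mul_one] at h₁
          rw [hξ, one_pow, mul_one] at h₂
          gcongr
  obtain ⟨T, hT, hlim⟩ := exists_tendstoWeak (l := atTop) (.of_forall hbound) fun η ξ => by
    simp only [sum_apply, inner_sum]
    exact ⟨_, (Summable.of_norm_bounded (((hs η).add (ht ξ)).div_const 2).summable
      fun j => hf j η ξ).hasSum⟩
  exact ⟨T, hT, hasWeakStarSum_of_summable (fun ξ η hξ hη => .of_norm_bounded
    (((summable_prod_vecForm ha hs hη).add (summable_prod_vecForm hb ht hξ)).div_const 2)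
    fun p => hf p.1 _ _) hlim⟩

theorem vecForm_star_mul_self (A : H →L[ℂ] H) (ξ : H) : vecForm ξ (star A * A) = ‖A ξ‖ ^ 2 := by
  rw [vecForm_apply, ContinuousLinearMap.star_eq_adjoint, mul_apply_eq_comp,
    ContinuousLinearMap.adjoint_inner_right]
  exact inner_self_eq_norm_sq (𝕜 := ℂ) (A ξ)

theorem norm_inner_star_comp_le (A : H →L[ℂ] H) (B : K →L[ℂ] K) {S : K →L[ℂ] H} (hS : ‖S‖ ≤ 1)
    (η : H) (ξ : K) : ‖⟪η, (star A ∘L S ∘L B) ξ⟫_ℂ‖ ≤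
      (vecForm η (star A * A) + vecForm ξ (star B * B)) / 2 := by
  rw [vecForm_star_mul_self, vecForm_star_mul_self, ContinuousLinearMap.star_eq_adjoint,
    ContinuousLinearMap.comp_apply, ContinuousLinearMap.comp_apply,
    ContinuousLinearMap.adjoint_inner_right]
  calc ‖⟪A η, S (B ξ)⟫_ℂ‖ ≤ ‖A η‖ * ‖S (B ξ)‖ := norm_inner_le_norm _ _
    _ ≤ ‖A η‖ * (1 * ‖B ξ‖) := by gcongr; exact S.le_of_opNorm_le hS _
    _ ≤ (‖A η‖ ^ 2 + ‖B ξ‖ ^ 2) / 2 := by nlinarith [sq_nonneg (‖A η‖ - ‖B ξ‖)]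

theorem norm_inner_le_of_nonneg {a : H →L[ℂ] H} (ha : 0 ≤ a) (η ξ : H) :
    ‖⟪η, a ξ⟫_ℂ‖ ≤ (vecForm η a + vecForm ξ a) / 2 := by
  have hr : star (CFC.sqrt a) = CFC.sqrt a := (CFC.sqrt_nonneg a).isSelfAdjoint
  have h := norm_inner_star_comp_le (CFC.sqrt a) (CFC.sqrt a)
    (ContinuousLinearMap.norm_id_le (𝕜 := ℂ) (E := H)) η ξ
  rw [hr, CFC.sqrt_mul_sqrt_self a ha] at h
  convert h
  exact (CFC.sqrt_mul_sqrt_self a ha).symm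

theorem hasWeakStarSum_of_nonneg {a : J → H →L[ℂ] H} {s : H →L[ℂ] H} (ha : ∀ j, 0 ≤ a j)
    (hs : IsSelfAdjoint s) (h : ∀ η, HasSum (fun j => vecForm η (a j)) (vecForm η s)) :
    HasWeakStarSum a s := by
  obtain ⟨T, -, hT⟩ := exists_hasWeakStarSum ha ha h h fun j => norm_inner_le_of_nonneg (ha j)
  have hTsa : IsSelfAdjoint T := hT.tendstoWeak.isSelfAdjoint fun F =>
    .of_nonneg (Finset.sum_nonneg fun j _ => ha j)
  have heq : ∀ η, vecForm η T = vecForm η s := fun η => (hT.hasSum_vecForm η).unique (h η)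
  rwa [le_antisymm (le_of_vecForm_le (hs.sub hTsa) fun η => (heq η).le)
    (le_of_vecForm_le (hTsa.sub hs) fun η => (heq η).ge)] at hT

theorem hasWeakStarSum_sigma {I : Type u} {J : I → Type u} {a : (Σ i, J i) → H →L[ℂ] H}
    {b : I → H →L[ℂ] H} {s : H →L[ℂ] H} (ha : ∀ p, 0 ≤ a p) (hs : HasWeakStarSum b s)
    (hb : ∀ i, HasWeakStarSum (fun j => a ⟨i, j⟩) (b i)) : HasWeakStarSum a s := by
  have hbsa : ∀ i, IsSelfAdjoint (b i) := fun i => (hb i).tendstoWeak.isSelfAdjoint fun F =>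
    .of_nonneg (Finset.sum_nonneg fun j _ => ha _)
  refine hasWeakStarSum_of_nonneg ha
    (hs.tendstoWeak.isSelfAdjoint fun F => isSelfAdjoint_sum F fun i _ => hbsa i) fun η => ?_
  have hfib : ∀ i, HasSum (fun j => vecForm η (a ⟨i, j⟩)) (vecForm η (b i)) :=
    fun i => (hb i).hasSum_vecForm η
  have hsum : Summable fun p => vecForm η (a p) :=
    (summable_sigma_of_nonneg fun p => vecForm_nonneg η (ha p)).2
      ⟨fun i => (hfib i).summable, by
        simpa only [(hfib _).tsum_eq] using (hs.hasSum_vecForm η).summable⟩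
  rw [(hs.hasSum_vecForm η).unique (hsum.hasSum.sigma hfib)]
  exact hsum.hasSum

end WeakStarSums

section SumsInAlgebra

variable {H₀ : Type u} [NormedAddCommGroup H₀] [InnerProductSpace ℂ H₀] [CompleteSpace H₀]
  {C : VonNeumannAlgebra H₀} {J : Type u} {c : J → C.toStarSubalgebra} {s : C.toStarSubalgebra}

theorem HasWeakStarSum.isLUB (hc : ∀ j, 0 ≤ c j)
    (h : HasWeakStarSum (fun j => (c j : H₀ →L[ℂ] H₀)) (s : H₀ →L[ℂ] H₀)) :
    IsLUB (Set.range fun F : Finset J => ∑ j ∈ F, c j) s := by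
  have hsa : ∀ F : Finset J, IsSelfAdjoint (∑ j ∈ F, (c j : H₀ →L[ℂ] H₀)) := fun F =>
    isSelfAdjoint_sum F fun j _ => IsSelfAdjoint.of_nonneg (hc j : 0 ≤ (c j : H₀ →L[ℂ] H₀))
  have hlub := isLUB_of_tendsto_vecForm (f := fun F : Finset J => ∑ j ∈ F, (c j : H₀ →L[ℂ] H₀))
    (Finset.sum_mono_set_of_nonneg fun j => hc j)
    (fun F => (h.tendstoWeak.isSelfAdjoint hsa).sub (hsa F)) h.tendstoWeak.vecForm
  have hle : ∀ (F : Finset J) (b : C.toStarSubalgebra),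
      ∑ j ∈ F, c j ≤ b ↔ ∑ j ∈ F, (c j : H₀ →L[ℂ] H₀) ≤ b := fun F b => by
    rw [← Subtype.coe_le_coe, AddSubmonoidClass.coe_finsetSum]
  refine ⟨Set.forall_mem_range.2 fun F => (hle F s).2 (hlub.1 ⟨F, rfl⟩), fun b hb => ?_⟩
  exact hlub.2 (Set.forall_mem_range.2 fun F => (hle F b).1 (hb ⟨F, rfl⟩))

theorem HasWeakStarSum.sum_le (hc : ∀ j, 0 ≤ c j)
    (h : HasWeakStarSum (fun j => (c j : H₀ →L[ℂ] H₀)) (s : H₀ →L[ℂ] H₀)) (F : Finset J) :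
    ∑ j ∈ F, c j ≤ s :=
  (h.isLUB hc).1 ⟨F, rfl⟩

theorem hasWeakStarSum_of_isLUB {H : Type u} [NormedAddCommGroup H] [InnerProductSpace ℂ H]
    [CompleteSpace H] {π : C.toStarSubalgebra →⋆ₐ[ℂ] (H →L[ℂ] H)} (hπ : IsNormal C π)
    (hc : ∀ j, 0 ≤ c j) (h : IsLUB (Set.range fun F : Finset J => ∑ j ∈ F, c j) s) :
    HasWeakStarSum (fun j => π (c j)) (π s) := by
  have hlim := hπ.tendstoWeak (Finset.sum_mono_set_of_nonneg hc) h
  simp only [map_sum] at hlim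
  have hpos : ∀ j, 0 ≤ π (c j) := fun j => map_nonneg π (hc j)
  exact hasWeakStarSum_of_nonneg hpos
    (hlim.isSelfAdjoint fun F => .of_nonneg (Finset.sum_nonneg fun j _ => hpos j))
    fun η => Complex.hasSum_re (tendstoWeak_sum_iff.1 hlim η η)

theorem exists_hasWeakStarSum_coe (hc : ∀ j, 0 ≤ c j) {b : C.toStarSubalgebra}
    (hb : ∀ F : Finset J, ∑ j ∈ F, c j ≤ b) : ∃ s : C.toStarSubalgebra, 0 ≤ s ∧ s ≤ b ∧
      HasWeakStarSum (fun j => (c j : H₀ →L[ℂ] H₀)) (s : H₀ →L[ℂ] H₀) := by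
  obtain ⟨s, hs, -⟩ := exists_isLUB_tendstoWeak_coe (Finset.sum_mono_set_of_nonneg hc) hb
  have hsum := hasWeakStarSum_of_isLUB (isNormal_subtype C) hc hs
  have h0 : 0 ≤ s := by simpa using hs.1 ⟨∅, rfl⟩
  exact ⟨s, h0, hs.2 (Set.forall_mem_range.2 hb), hsum⟩

theorem NormalEmbedding.exists_hasWeakStarSum {Z K H : Type u}
    [NormedAddCommGroup Z] [NormedSpace ℂ Z] [Module C.toStarSubalgebra Z]
    [NormedAddCommGroup K] [InnerProductSpace ℂ K] [CompleteSpace K]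
    [NormedAddCommGroup H] [InnerProductSpace ℂ H] [CompleteSpace H]
    (E : NormalEmbedding C Z K H) {z : J → Z} (hc : ∀ j, 0 ≤ c j) (hz : ∀ j, ‖z j‖ ≤ 1)
    (hs : HasWeakStarSum (fun j => (c j : H₀ →L[ℂ] H₀)) (s : H₀ →L[ℂ] H₀)) :
    ∃ w, ‖w‖ ≤ ‖s‖ ∧ HasWeakStarSum (fun j => E.emb (c j • z j)) w := by
  have hbound : ∀ j η ξ, ‖⟪η, E.emb (c j • z j) ξ⟫_ℂ‖ ≤
      (vecForm η (E.left (c j)) + vecForm ξ (E.right (c j))) / 2 := fun j η ξ => by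
    obtain ⟨r, hr, hcr⟩ : ∃ r, star r = r ∧ c j = r * r :=
      ⟨CFC.sqrt (c j), (CFC.sqrt_nonneg (c j)).isSelfAdjoint,
        (CFC.sqrt_mul_sqrt_self (c j) (hc j)).symm⟩
    have h := norm_inner_star_comp_le (E.left r) (E.right r)
      ((E.emb.norm_map (z j)).trans_le (hz j)) η ξ
    rwa [← map_star, ← map_star, hr, ← map_mul, ← map_mul, ← hcr, ← E.emb_right, ← E.emb_left,
      smul_smul, ← hcr] at h
  have hlub := hs.isLUB hc
  obtain ⟨w, hw, hsum⟩ := CNRM.exists_hasWeakStarSum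
    (fun j => map_nonneg E.left (hc j)) (fun j => map_nonneg E.right (hc j))
    (hasWeakStarSum_of_isLUB E.left_normal hc hlub).hasSum_vecForm
    (hasWeakStarSum_of_isLUB E.right_normal hc hlub).hasSum_vecForm hbound
  exact ⟨w, by linarith [norm_rep_le E.left s, norm_rep_le E.right s], hsum⟩

end SumsInAlgebra

section Projections

variable {H₀ : Type u} [NormedAddCommGroup H₀] [InnerProductSpace ℂ H₀] [CompleteSpace H₀]
  {C : VonNeumannAlgebra H₀}

theorem starProjection_range_mem (a : C.toStarSubalgebra) :
    (a : H₀ →L[ℂ] H₀).range.topologicalClosure.starProjection ∈ C.toStarSubalgebra := by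
  refine (VonNeumannAlgebra.IsStarProjection.mem_iff isStarProjection_starProjection C).2
    fun y hy => ?_
  rw [Submodule.range_starProjection, Module.End.mem_invtSubmodule]
  have hya : ∀ ξ, (a : H₀ →L[ℂ] H₀) (y ξ) = y ((a : H₀ →L[ℂ] H₀) ξ) := fun ξ =>
    congrArg (fun T : H₀ →L[ℂ] H₀ => T ξ) (VonNeumannAlgebra.mem_commutant_iff.1 hy a a.2)
  have hmaps : Set.MapsTo y (a : H₀ →L[ℂ] H₀).range (a : H₀ →L[ℂ] H₀).range := by
    rintro _ ⟨ξ, rfl⟩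
    exact ⟨y ξ, hya ξ⟩
  exact fun ξ hξ => hmaps.closure y.continuous hξ

theorem exists_range_projection (a : C.toStarSubalgebra) :
    ∃ p : C.toStarSubalgebra, IsStarProjection p ∧ p * a = a ∧
      ∀ b : C.toStarSubalgebra, b * a = 0 → b * p = 0 := by
  let U := (a : H₀ →L[ℂ] H₀).range.topologicalClosure
  have hU : IsStarProjection U.starProjection := isStarProjection_starProjection
  have haU : ∀ ξ, (a : H₀ →L[ℂ] H₀) ξ ∈ U := fun ξ =>
    Submodule.le_topologicalClosure _ (LinearMap.mem_range_self _ ξ)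
  refine ⟨⟨_, starProjection_range_mem a⟩, ⟨Subtype.ext hU.1, Subtype.ext hU.2⟩,
    Subtype.ext (ContinuousLinearMap.ext fun ξ => Submodule.starProjection_eq_self_iff.2 (haU ξ)),
    fun b hb => Subtype.ext (ContinuousLinearMap.ext fun ξ => ?_)⟩
  have hle : U ≤ (b : H₀ →L[ℂ] H₀).ker := by
    refine Submodule.topologicalClosure_minimal _ ?_ (b : H₀ →L[ℂ] H₀).isClosed_ker
    rintro _ ⟨ζ, rfl⟩
    exact congrArg (fun T : C.toStarSubalgebra => (T : H₀ →L[ℂ] H₀) ζ) hb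
  exact hle (U.starProjection_apply_mem ξ)

theorem vecForm_rep_projection {H : Type u} [NormedAddCommGroup H] [InnerProductSpace ℂ H]
    [CompleteSpace H] (π : C.toStarSubalgebra →⋆ₐ[ℂ] (H →L[ℂ] H)) {p : C.toStarSubalgebra}
    (hp : IsStarProjection p) (ξ : H) : vecForm ξ (π p) = ‖π p ξ‖ ^ 2 := by
  rw [← vecForm_star_mul_self, ← map_star, ← map_mul, hp.2, hp.1]

theorem vecForm_projection_mul {q : C.toStarSubalgebra} (hq : IsStarProjection q) {ξ : H₀}
    (hξ : (q : H₀ →L[ℂ] H₀) ξ = ξ) (c : C.toStarSubalgebra) :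
    vecForm ξ ((q * c : C.toStarSubalgebra) : H₀ →L[ℂ] H₀) = vecForm ξ (c : H₀ →L[ℂ] H₀) := by
  have hadj : ContinuousLinearMap.adjoint (q : H₀ →L[ℂ] H₀) = q := congrArg Subtype.val hq.2
  rw [vecForm_apply, vecForm_apply, MulMemClass.coe_mul, mul_apply_eq_comp,
    ← ContinuousLinearMap.adjoint_inner_left, hadj, hξ]

variable [IsMulCommutative C.toStarSubalgebra]

theorem projection_mul_nonneg {p c : C.toStarSubalgebra} (hp : IsStarProjection p) (hc : 0 ≤ c) :
    0 ≤ p * c := by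
  have h := star_left_conjugate_nonneg hc p
  rwa [hp.2, mul_comm, ← mul_assoc, hp.1] at h

theorem projection_mul_le_mul {p c d : C.toStarSubalgebra} (hp : IsStarProjection p) (h : c ≤ d) :
    p * c ≤ p * d := by
  rw [← sub_nonneg, ← mul_sub]
  exact projection_mul_nonneg hp (sub_nonneg.2 h)

/-- The witness is the range projection of `q (r - s)⁺`. -/
theorem exists_projection_le {s q : C.toStarSubalgebra} (hs : IsSelfAdjoint s)
    (hq : IsStarProjection q) {r : ℝ} {ξ : H₀} (hξ : (q : H₀ →L[ℂ] H₀) ξ = ξ)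
    (h : vecForm ξ (s : H₀ →L[ℂ] H₀) < r * ‖ξ‖ ^ 2) :
    ∃ p : C.toStarSubalgebra, IsStarProjection p ∧ p ≠ 0 ∧ p * q = p ∧ p * s ≤ (r : ℂ) • p := by
  let d : C.toStarSubalgebra := (r : ℂ) • 1 - s
  have hd : IsSelfAdjoint d := .sub (by simp [isSelfAdjoint_iff]) hs
  have hdecomp : d⁺ - d⁻ = d := CFC.posPart_sub_negPart d hd
  obtain ⟨p, hp, hpa, hpb⟩ := exists_range_projection (q * d⁺)
  have hpd : p * d⁻ = 0 := by
    rw [mul_comm]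
    exact hpb _ (by rw [mul_left_comm, CFC.negPart_mul_posPart, mul_zero])
  have hpq : p * q = p := by
    have := hpb (1 - q) (by rw [← mul_assoc, sub_mul, one_mul, hq.1, sub_self, zero_mul])
    rw [sub_mul, one_mul, sub_eq_zero] at this
    rw [mul_comm, ← this]
  refine ⟨p, hp, ?_, hpq, ?_⟩
  · rintro rfl
    have hneg : q * d = -(q * d⁻) := by
      rw [← hdecomp, mul_sub, ← hpa, zero_mul, zero_sub, hdecomp]
    have hle : vecForm ξ (d : H₀ →L[ℂ] H₀) ≤ 0 := by
      rw [← vecForm_projection_mul hq hξ, hneg, NegMemClass.coe_neg, map_neg, neg_nonpos]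
      exact vecForm_nonneg ξ (projection_mul_nonneg hq (CFC.negPart_nonneg d))
    have hform : vecForm ξ (d : H₀ →L[ℂ] H₀) = r * ‖ξ‖ ^ 2 - vecForm ξ (s : H₀ →L[ℂ] H₀) := by
      have : (d : H₀ →L[ℂ] H₀) = r • 1 - (s : H₀ →L[ℂ] H₀) := rfl
      rw [this, map_sub, map_smul, vecForm_one, smul_eq_mul]
    linarith
  · rw [← sub_nonneg]
    have : (r : ℂ) • p - p * s = p * d⁺ := by
      rw [← sub_zero (p * d⁺), ← hpd, ← mul_sub, hdecomp, mul_sub, mul_smul_comm, mul_one]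
    rw [this]
    exact projection_mul_nonneg hp (CFC.posPart_nonneg d)

/-- A maximal orthogonal family of projections of `C`, along which operators are cut into pieces.
Some members may be zero. -/
structure IsPartition {J : Type u} (p : J → C.toStarSubalgebra) : Prop where
  proj : ∀ j, IsStarProjection (p j)
  orth : Pairwise fun i j => p i * p j = 0
  max : ∀ q, IsStarProjection q → (∀ j, q * p j = 0) → q = 0

theorem exists_partition (P : C.toStarSubalgebra → Prop)
    (h : ∀ q, IsStarProjection q → q ≠ 0 → ∃ p, IsStarProjection p ∧ p ≠ 0 ∧ p * q = p ∧ P p) :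
    ∃ (J : Type u) (p : J → C.toStarSubalgebra), IsPartition p ∧ ∀ j, P (p j) := by
  let orthFamilies : Set (Set C.toStarSubalgebra) :=
    {S | (∀ p ∈ S, IsStarProjection p ∧ P p) ∧ S.Pairwise fun a b => a * b = 0}
  obtain ⟨S, hS⟩ := zorn_subset orthFamilies fun c hc hchain =>
    ⟨⋃₀ c, ⟨fun p ⟨s, hs, hp⟩ => (hc hs).1 p hp,
      (Set.pairwise_sUnion hchain.directedOn).2 fun s hs => (hc hs).2⟩,
      fun s hs => Set.subset_sUnion_of_mem hs⟩
  refine ⟨S, Subtype.val, ⟨fun j => (hS.prop.1 j j.2).1, fun i j hij => hS.prop.2 i.2 j.2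
    fun e => hij (Subtype.ext e), fun q hq hqS => ?_⟩, fun j => (hS.prop.1 j j.2).2⟩
  by_contra hq0
  obtain ⟨p, hp, hp0, hpq, hPp⟩ := h q hq hq0
  have hpS : ∀ e ∈ S, p * e = 0 := fun e he => by
    rw [← hpq, mul_assoc, hqS ⟨e, he⟩, mul_zero]
  have hins : insert p S ∈ orthFamilies :=
    ⟨Set.forall_mem_insert.2 ⟨⟨hp, hPp⟩, hS.prop.1⟩,
      hS.prop.2.insert fun e he _ => ⟨hpS e he, mul_comm p e ▸ hpS e he⟩⟩
  have hmem : p ∈ S := hS.le_of_ge hins (Set.subset_insert p S) (Set.mem_insert p S)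
  exact hp0 (hp.1.symm.trans (hpS p hmem))

namespace IsPartition

variable {J : Type u} {p : J → C.toStarSubalgebra}

theorem isStarProjection_sum (hp : IsPartition p) (F : Finset J) :
    IsStarProjection (∑ j ∈ F, p j) := by
  refine ⟨?_, isSelfAdjoint_sum F fun j _ => (hp.proj j).2⟩
  rw [IsIdempotentElem, Finset.sum_mul_sum]
  refine Finset.sum_congr rfl fun j hj => ?_
  rw [Finset.sum_eq_single_of_mem j hj fun i _ hij => hp.orth hij.symm, (hp.proj j).1]

theorem hasWeakStarSum_one (hp : IsPartition p) :
    HasWeakStarSum (fun j => (p j : H₀ →L[ℂ] H₀)) ((1 : C.toStarSubalgebra) : H₀ →L[ℂ] H₀) := by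
  have hnonneg : ∀ j, 0 ≤ p j := fun j => (hp.proj j).nonneg
  obtain ⟨s, -, hs1, hs⟩ := exists_hasWeakStarSum_coe hnonneg
    fun F => sub_nonneg.1 (hp.isStarProjection_sum F).one_sub.nonneg
  obtain ⟨q, hq, hqs, hann⟩ := exists_range_projection (1 - s)
  have hpart : ∀ j, p j * (1 - s) = 0 := fun j => by
    have hle : p j ≤ s := by simpa using hs.sum_le hnonneg {j}
    refine le_antisymm ?_ (projection_mul_nonneg (hp.proj j) (sub_nonneg.2 hs1))
    rw [mul_sub, mul_one, sub_nonpos]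
    simpa only [(hp.proj j).1.eq] using projection_mul_le_mul (hp.proj j) hle
  have hq0 : q = 0 := hp.max q hq fun j => by rw [mul_comm, hann _ (hpart j)]
  rw [hq0, zero_mul] at hqs
  rwa [← sub_eq_zero.1 hqs.symm] at hs

theorem hasSum_norm_sq (hp : IsPartition p) {H : Type u} [NormedAddCommGroup H]
    [InnerProductSpace ℂ H] [CompleteSpace H] {π : C.toStarSubalgebra →⋆ₐ[ℂ] (H →L[ℂ] H)}
    (hπ : IsNormal C π) (ξ : H) : HasSum (fun j => ‖π (p j) ξ‖ ^ 2) (‖ξ‖ ^ 2) := by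
  have hnonneg : ∀ j, 0 ≤ p j := fun j => (hp.proj j).nonneg
  have h := (hasWeakStarSum_of_isLUB hπ hnonneg
    (hp.hasWeakStarSum_one.isLUB hnonneg)).hasSum_vecForm ξ
  simpa only [vecForm_rep_projection π (hp.proj _), map_one, vecForm_one] using h

theorem norm_le (hp : IsPartition p) {K H : Type u} [NormedAddCommGroup H]
    [InnerProductSpace ℂ H] [CompleteSpace H] [NormedAddCommGroup K]
    [InnerProductSpace ℂ K] [CompleteSpace K] {π : C.toStarSubalgebra →⋆ₐ[ℂ] (H →L[ℂ] H)}
    {σ : C.toStarSubalgebra →⋆ₐ[ℂ] (K →L[ℂ] K)}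
    (hπ : IsNormal C π) (hσ : IsNormal C σ) {T : K →L[ℂ] H} (hT : ∀ c, π c ∘L T = T ∘L σ c)
    {ε : ℝ} (hε : 0 ≤ ε) (h : ∀ j, ‖π (p j) ∘L T‖ ≤ ε) : ‖T‖ ≤ ε := by
  refine T.opNorm_le_bound hε fun ξ => le_of_sq_le_sq ?_ (by positivity)
  rw [mul_pow]
  refine hasSum_le (fun j => ?_) (hp.hasSum_norm_sq hπ (T ξ))
    ((hp.hasSum_norm_sq hσ ξ).mul_left (ε ^ 2))
  have hcut : π (p j) ∘L T = (π (p j) ∘L T) ∘L σ (p j) := by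
    rw [ContinuousLinearMap.comp_assoc, ← hT, ← ContinuousLinearMap.comp_assoc,
      ← ContinuousLinearMap.mul_def, ← map_mul, (hp.proj j).1]
  rw [← mul_pow]
  gcongr
  calc ‖π (p j) (T ξ)‖ = ‖(π (p j) ∘L T) (σ (p j) ξ)‖ := congrArg (fun S => ‖S ξ‖) hcut
    _ ≤ ε * ‖σ (p j) ξ‖ := ContinuousLinearMap.le_of_opNorm_le _ (h j) _

end IsPartition

end Projections

section PositiveFunctionals

open scoped ComplexOrder

theorem exists_linearMap_le_seminorm {V : Type*} [AddCommGroup V] [Module ℂ V]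
    (p : Seminorm ℂ V) (w : V) : ∃ θ : V →ₗ[ℂ] ℂ, (∀ v, ‖θ v‖ ≤ p v) ∧ θ w = p w := by
  let : SeminormedAddCommGroup V := p.toAddGroupSeminorm.toSeminormedAddCommGroup
  let : NormedSpace ℂ V := { norm_smul_le := fun a v => (map_smul_eq_mul p a v).le }
  obtain ⟨g, hg, hgw⟩ := exists_dual_vector'' ℂ w
  exact ⟨g, fun v => (g.le_of_opNorm_le hg v).trans (one_mul _).le, hgw⟩

variable {A : Type*} [CStarAlgebra A] [PartialOrder A] [StarOrderedRing A]

-- The `f i` are the images of a partition of unity on the spectrum of `a`.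
theorem exists_norm_cfc_sub_sum_smul_le (a : A) [IsStarNormal a] {ε : ℝ} (hε : 0 < ε) :
    ∃ (ι : Type) (_ : Fintype ι) (z : ι → ℂ) (f : ι → A), (∀ i, 0 ≤ f i) ∧
      ∀ h : ℂ → ℂ, LipschitzWith 1 h → ‖cfc h a - ∑ i, h (z i) • f i‖ ≤ ε := by
  obtain ⟨t, -, ht, hcover⟩ := (spectrum.isCompact (𝕜 := ℂ) a).finite_cover_balls hε
  let _ : Fintype t := ht.fintype
  obtain ⟨g, hg⟩ := PartitionOfUnity.exists_isSubordinate (spectrum.isCompact a).isClosed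
    (fun z : t => Metric.ball (z : ℂ) ε) (fun z => Metric.isOpen_ball)
    (by rwa [Set.iUnion_coe_set])
  have hcont : ∀ z, Continuous fun x => (g z x : ℂ) :=
    fun z => Complex.continuous_ofReal.comp (g z).continuous
  refine ⟨t, ht.fintype, (↑), fun z => cfc (fun x => (g z x : ℂ)) a,
    fun z => cfc_nonneg (R := ℂ) fun x _ => by exact_mod_cast g.nonneg z x, fun h hh => ?_⟩
  have hmul : ∀ z : t, Continuous fun x => h z * (g z x : ℂ) :=
    fun z => continuous_const.mul (hcont z)
  have hrhs : ContinuousOn (fun x => (∑ z : t, fun x => h z * (g z x : ℂ)) x) (spectrum ℂ a) := by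
    simpa only [Finset.sum_apply] using
      (continuous_finsetSum Finset.univ fun z _ => hmul z).continuousOn
  have hsum : cfc h a - ∑ z : t, h z • cfc (fun x => (g z x : ℂ)) a =
      cfc (fun x => h x - (∑ z : t, fun x => h z * (g z x : ℂ)) x) a := by
    rw [cfc_sub _ _ _ hh.continuous.continuousOn hrhs,
      cfc_sum _ _ _ fun z _ => (hmul z).continuousOn]
    exact congrArg _ (Finset.sum_congr rfl fun z _ =>
      (cfc_const_mul _ _ _ (hcont z).continuousOn).symm)
  have hnear : ∀ x, ∀ z : t, ‖(g z x : ℂ) * (h x - h z)‖ ≤ g z x * ε := by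
    intro x z
    rw [norm_mul, Complex.norm_real, Real.norm_of_nonneg (g.nonneg z x)]
    by_cases hz : g z x = 0
    · simp [hz]
    · have hxz : dist x z < ε := hg z (subset_tsupport _ hz)
      exact mul_le_mul_of_nonneg_left
        ((hh.norm_sub_le x z).trans (by simpa [← dist_eq_norm] using hxz.le)) (g.nonneg z x)
  rw [hsum]
  refine norm_cfc_le hε.le fun x hx => ?_
  have hone : ∑ z, g z x = 1 := by rw [← finsum_eq_sum_of_fintype, g.sum_eq_one hx]
  calc ‖h x - (∑ z : t, fun x => h z * (g z x : ℂ)) x‖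
      = ‖∑ z, (g z x : ℂ) * (h x - h z)‖ := by
        rw [Finset.sum_apply]
        simp_rw [mul_sub, Finset.sum_sub_distrib, ← Finset.sum_mul, mul_comm (h _)]
        rw [← Complex.ofReal_sum, hone, Complex.ofReal_one, one_mul]
    _ ≤ ∑ z, g z x * ε := norm_sum_le_of_le _ fun z _ => hnear x z
    _ = ε := by rw [← Finset.sum_mul, hone, one_mul]

theorem abs_eq_cfc_norm (a : A) [IsStarNormal a] :
    CFC.abs a = cfc (fun z : ℂ => (‖z‖ : ℂ)) a := by
  rw [CFC.abs_eq_cfcₙ_coe_norm ℂ a, cfcₙ_eq_cfc (by fun_prop) (by simp)]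
  rfl

variable {θ φ : A →ₗ[ℂ] ℂ}

theorem re_apply_le_norm_mul (hφ : ∀ a, 0 ≤ a → 0 ≤ (φ a).re) {a : A} (ha : IsSelfAdjoint a) :
    (φ a).re ≤ ‖a‖ * (φ 1).re := by
  have h := hφ _ (sub_nonneg.2 ha.le_algebraMap_norm_self)
  rw [Algebra.algebraMap_eq_smul_one, ← Complex.coe_smul, map_sub, map_smul, smul_eq_mul,
    Complex.sub_re, Complex.re_ofReal_mul] at h
  linarith

theorem norm_apply_le_four_mul (h : ∀ a, 0 ≤ a → ‖θ a‖ ≤ (φ a).re) (a : A) :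
    ‖θ a‖ ≤ 4 * (‖a‖ * (φ 1).re) := by
  have hφ : ∀ a, 0 ≤ a → 0 ≤ (φ a).re := fun a ha => (norm_nonneg _).trans (h a ha)
  obtain ⟨x, hx, hxa, hsum⟩ := CStarAlgebra.exists_sum_four_nonneg a
  calc ‖θ a‖ = ‖∑ i : Fin 4, Complex.I ^ (i : ℕ) * θ (x i)‖ := by
        conv_lhs => rw [hsum]
        simp_rw [map_sum, map_smul, smul_eq_mul]
    _ ≤ ∑ _i : Fin 4, ‖a‖ * (φ 1).re := norm_sum_le_of_le _ fun i _ => by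
        rw [norm_mul, norm_pow, Complex.norm_I, one_pow, one_mul]
        exact (h _ (hx i)).trans ((re_apply_le_norm_mul hφ (.of_nonneg (hx i))).trans
          (mul_le_mul_of_nonneg_right (hxa i) (hφ 1 zero_le_one)))
    _ = 4 * (‖a‖ * (φ 1).re) := by simp

theorem norm_apply_le_apply_abs (h : ∀ a, 0 ≤ a → ‖θ a‖ ≤ (φ a).re) (a : A) [IsStarNormal a] :
    ‖θ a‖ ≤ (φ (CFC.abs a)).re := by
  have hφ : ∀ a, 0 ≤ a → 0 ≤ (φ a).re := fun a ha => (norm_nonneg _).trans (h a ha)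
  have hone : 0 ≤ (φ 1).re := hφ 1 zero_le_one
  refine le_of_forall_pos_le_add fun δ hδ => ?_
  obtain ⟨ε, hε, hεδ⟩ : ∃ ε > 0, ε * (5 * (φ 1).re) ≤ δ :=
    ⟨δ / (5 * (φ 1).re + 1), by positivity, by
      rw [div_mul_eq_mul_div, div_le_iff₀ (by positivity)]; nlinarith⟩
  obtain ⟨ι, _, z, f, hf, hfa⟩ := exists_norm_cfc_sub_sum_smul_le a hε
  have herr : ‖a - ∑ i, z i • f i‖ ≤ ε := by
    simpa only [id, cfc_id ℂ a] using hfa id .id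
  have herr_abs : ‖∑ i, (‖z i‖ : ℂ) • f i - CFC.abs a‖ ≤ ε := by
    rw [norm_sub_rev, abs_eq_cfc_norm]
    exact hfa (fun z => (‖z‖ : ℂ)) (.of_dist_le_mul fun x y => by
      simpa [dist_eq_norm, ← Complex.ofReal_sub] using abs_norm_sub_norm_le x y)
  have hsa : IsSelfAdjoint (∑ i, (‖z i‖ : ℂ) • f i - CFC.abs a) := by
    refine .sub (.of_nonneg (Finset.sum_nonneg fun i _ => ?_)) (.of_nonneg (CFC.abs_nonneg a))
    rw [Complex.coe_smul]
    exact smul_nonneg (norm_nonneg _) (hf i)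
  have hsum : ‖θ (∑ i, z i • f i)‖ ≤ (φ (∑ i, (‖z i‖ : ℂ) • f i)).re := by
    simp_rw [map_sum, map_smul, smul_eq_mul, Complex.re_sum, Complex.re_ofReal_mul]
    refine norm_sum_le_of_le _ fun i _ => ?_
    rw [norm_mul]
    exact mul_le_mul_of_nonneg_left (h _ (hf i)) (norm_nonneg _)
  have hθ := (norm_apply_le_four_mul h (a - ∑ i, z i • f i)).trans
    (mul_le_mul_of_nonneg_left (mul_le_mul_of_nonneg_right herr hone) (by norm_num))
  have hφa := (re_apply_le_norm_mul hφ hsa).trans (mul_le_mul_of_nonneg_right herr_abs hone)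
  rw [map_sub] at hθ hφa
  rw [Complex.sub_re] at hφa
  linarith [norm_le_norm_add_norm_sub' (θ a) (θ (∑ i, z i • f i))]

end PositiveFunctionals

section Forms

variable {H : Type*} [NormedAddCommGroup H] [InnerProductSpace ℂ H] [CompleteSpace H]
  {M : Type*} [AddCommGroup M] [Module ℂ M] {j : M →ₗ[ℂ] H}

variable (j) in
/-- The orthogonal projection onto the closure of the range of `j`. -/
def rangeProjection : H →L[ℂ] H := (LinearMap.range j).topologicalClosure.starProjection

theorem isStarProjection_rangeProjection : IsStarProjection (rangeProjection j) :=
  isStarProjection_starProjection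

theorem inner_rangeProjection_left (η ξ : H) :
    ⟪rangeProjection j η, ξ⟫_ℂ = ⟪η, rangeProjection j ξ⟫_ℂ :=
  Submodule.inner_starProjection_left_eq_right _ η ξ

theorem eq_of_inner_apply_eq {T S : H →L[ℂ] H}
    (hT : rangeProjection j * T * rangeProjection j = T)
    (hS : rangeProjection j * S * rangeProjection j = S)
    (h : ∀ b a, ⟪j b, T (j a)⟫_ℂ = ⟪j b, S (j a)⟫_ℂ) : T = S := by
  have hmem : ∀ ζ, rangeProjection j ζ ∈ closure (Set.range j) := fun ζ => by
    rw [← LinearMap.coe_range, ← Submodule.topologicalClosure_coe]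
    exact Submodule.starProjection_apply_mem _ ζ
  have hclosure : ∀ η ∈ closure (Set.range j), ∀ ξ ∈ closure (Set.range j),
      ⟪η, (T - S) ξ⟫_ℂ ∈ closure {(0 : ℂ)} := fun η hη ξ hξ => by
    refine map_mem_closure₂ (f := fun η ξ => ⟪η, (T - S) ξ⟫_ℂ) (by fun_prop) hη hξ ?_
    rintro _ ⟨b, rfl⟩ _ ⟨a, rfl⟩
    rw [sub_apply, inner_sub_right, h, sub_self, Set.mem_singleton_iff]
  rw [← hT, ← hS]
  ext ξ
  refine ext_inner_left ℂ fun η => sub_eq_zero.1 ?_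
  rw [mul_apply_eq_comp, mul_apply_eq_comp, mul_apply_eq_comp, mul_apply_eq_comp,
    ← inner_rangeProjection_left, ← inner_rangeProjection_left, ← inner_sub_right, ← sub_apply]
  simpa only [closure_singleton, Set.mem_singleton_iff] using hclosure _ (hmem η) _ (hmem ξ)

theorem exists_inner_apply_eq (B : M →ₗ⋆[ℂ] M →ₗ[ℂ] ℂ) {m : ℝ} (hm : 0 ≤ m)
    (hB : ∀ b a, ‖B b a‖ ≤ m * ‖j b‖ * ‖j a‖) :
    ∃ T : H →L[ℂ] H, ‖T‖ ≤ m ∧ rangeProjection j * T * rangeProjection j = T ∧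
      ∀ b a, ⟪j b, T (j a)⟫_ℂ = B b a := by
  let U := (LinearMap.range j).topologicalClosure
  let e : M →ₗ[ℂ] U := j.codRestrict U fun a =>
    Submodule.le_topologicalClosure _ (LinearMap.mem_range_self j a)
  have he : DenseRange e := by
    rw [DenseRange, Subtype.dense_iff, ← Set.range_comp]
    exact subset_rfl
  let R : M → U := fun b => (InnerProductSpace.toDual ℂ U).symm ((B b).extendOfNorm e)
  have hR : ∀ b a, ⟪R b, e a⟫_ℂ = B b a := fun b a =>
    InnerProductSpace.toDual_symm_apply.trans (LinearMap.extendOfNorm_eq he ⟨_, hB b⟩ a)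
  let S : M →ₗ[ℂ] U :=
    { toFun := R
      map_add' b b' := he.eq_of_inner_left ℂ fun a => by
        simp only [inner_add_left, hR, map_add, LinearMap.add_apply]
      map_smul' c b := he.eq_of_inner_left ℂ fun a => by
        simp only [inner_smul_left, hR, map_smulₛₗ, LinearMap.smul_apply, smul_eq_mul,
          RingHom.id_apply] }
  have hS : ∀ b, ‖S b‖ ≤ m * ‖e b‖ := fun b =>
    ((InnerProductSpace.toDual ℂ U).symm.norm_map _).trans_le
      (LinearMap.opNorm_extendOfNorm_le he (by positivity) (hB b))
  let T : U →L[ℂ] U := ContinuousLinearMap.adjoint (S.extendOfNorm e)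
  have hT : ‖T‖ ≤ m := (LinearIsometryEquiv.norm_map _ _).trans_le
    (LinearMap.opNorm_extendOfNorm_le he hm hS)
  have hproj : ∀ ζ : U, U.orthogonalProjectionOnto ζ = ζ :=
    U.orthogonalProjectionOnto_mem_subspace_eq_self
  refine ⟨U.subtypeL ∘L T ∘L U.orthogonalProjectionOnto, ?_, ?_, fun b a => ?_⟩
  · refine ContinuousLinearMap.opNorm_le_bound _ hm fun ξ => ?_
    exact (T.le_of_opNorm_le hT _).trans
      (mul_le_mul_of_nonneg_left (U.norm_orthogonalProjectionOnto_apply_le ξ) hm)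
  · ext ξ
    change ((U.orthogonalProjectionOnto (T (U.orthogonalProjectionOnto
      (U.orthogonalProjectionOnto ξ : H)) : H) : U) : H) = T (U.orthogonalProjectionOnto ξ)
    rw [hproj, hproj]
  · change ⟪e b, T (U.orthogonalProjectionOnto (e a : H))⟫_ℂ = B b a
    rw [hproj, ContinuousLinearMap.adjoint_inner_right, LinearMap.extendOfNorm_eq he ⟨m, hS⟩]
    exact hR b a

end Forms

section Decompositions

variable {H₀ : Type u} [NormedAddCommGroup H₀] [InnerProductSpace ℂ H₀] [CompleteSpace H₀]
  {C : VonNeumannAlgebra H₀} [IsMulCommutative C.toStarSubalgebra]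
  {X Y : Type u}
  [NormedAddCommGroup X] [Module C.toStarSubalgebra X]
  [NormedAddCommGroup Y] [Module C.toStarSubalgebra Y]

variable (C) in
/-- The elementary tensor `x ⊗ y` in the algebraic tensor product, as a bilinear map. -/
def algTmul : X →ₗ[C.toStarSubalgebra] Y →ₗ[C.toStarSubalgebra] AlgTensor C X Y :=
  TensorProduct.mk C.toStarSubalgebra X Y

theorem algTensor_induction {p : AlgTensor C X Y → Prop} (zero : p 0)
    (tmul : ∀ x y, p (algTmul C x y)) (add : ∀ v w, p v → p w → p (v + w)) (v : AlgTensor C X Y) :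
    p v :=
  TensorProduct.induction_on v zero tmul add

variable (C X Y) in
/-- The pairs `(∑ i, c i • (x i ⊗ y i), ∑ i, (‖x i‖ * ‖y i‖) • c i)` of a finite sum of elementary
tensors with positive coefficients `c i` and its total coefficient. -/
def decompositions : AddSubmonoid (AlgTensor C X Y × C.toStarSubalgebra) :=
  AddSubmonoid.closure {d | ∃ (c : C.toStarSubalgebra) (x : X) (y : Y), 0 ≤ c ∧
    d = (c • algTmul C x y, ((‖x‖ * ‖y‖ : ℝ) : ℂ) • c)}

theorem smul_algTmul_mem_decompositions {c : C.toStarSubalgebra} (hc : 0 ≤ c) (x : X) (y : Y) :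
    (c • algTmul C x y, ((‖x‖ * ‖y‖ : ℝ) : ℂ) • c) ∈ decompositions C X Y :=
  AddSubmonoid.subset_closure ⟨c, x, y, hc, rfl⟩

theorem nonneg_of_mem_decompositions {d : AlgTensor C X Y × C.toStarSubalgebra}
    (hd : d ∈ decompositions C X Y) : 0 ≤ d.2 := by
  induction hd using AddSubmonoid.closure_induction with
  | mem d hd =>
    obtain ⟨c, x, y, hc, rfl⟩ := hd
    rw [Complex.coe_smul]
    exact smul_nonneg (by positivity) hc
  | zero => exact le_rfl
  | add d e _ _ hd he => exact add_nonneg hd he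

theorem projection_smul_mem_decompositions {p : C.toStarSubalgebra} (hp : IsStarProjection p)
    {d : AlgTensor C X Y × C.toStarSubalgebra} (hd : d ∈ decompositions C X Y) :
    (p • d.1, p * d.2) ∈ decompositions C X Y := by
  induction hd using AddSubmonoid.closure_induction with
  | mem d hd =>
    obtain ⟨c, x, y, hc, rfl⟩ := hd
    have h := smul_algTmul_mem_decompositions (projection_mul_nonneg hp hc) x y
    rwa [mul_smul, ← mul_smul_comm] at h
  | zero => simp [← Prod.zero_eq_mk]
  | add d e _ _ hd he => simpa [mul_add] using add_mem hd he

theorem exists_mem_decompositions (v : AlgTensor C X Y) : ∃ s, (v, s) ∈ decompositions C X Y := by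
  induction v using algTensor_induction with
  | zero => exact ⟨0, zero_mem _⟩
  | tmul x y => exact ⟨_, by simpa using smul_algTmul_mem_decompositions (C := C) zero_le_one x y⟩
  | add v w hv hw =>
    obtain ⟨s, hs⟩ := hv
    obtain ⟨t, ht⟩ := hw
    exact ⟨s + t, add_mem hs ht⟩

/-- The set of all values `⟪ξ, s ξ⟫`, where `s` is the total coefficient of a decomposition of
`v`. -/
def vecValues (ξ : H₀) (v : AlgTensor C X Y) : Set ℝ :=
  (fun s : C.toStarSubalgebra => vecForm ξ (s : H₀ →L[ℂ] H₀)) ''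
    {s | (v, s) ∈ decompositions C X Y}

theorem vecValues_nonempty (ξ : H₀) (v : AlgTensor C X Y) : (vecValues ξ v).Nonempty :=
  let ⟨s, hs⟩ := exists_mem_decompositions v
  ⟨_, s, hs, rfl⟩

theorem nonneg_of_mem_vecValues {ξ : H₀} {v : AlgTensor C X Y} {r : ℝ}
    (hr : r ∈ vecValues ξ v) : 0 ≤ r := by
  obtain ⟨s, hs, rfl⟩ := hr
  exact vecForm_nonneg ξ (nonneg_of_mem_decompositions hs)

theorem sInf_vecValues_le {ξ : H₀} {v : AlgTensor C X Y} {r : ℝ} (hr : r ∈ vecValues ξ v) :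
    sInf (vecValues ξ v) ≤ r :=
  csInf_le ⟨0, fun _ => nonneg_of_mem_vecValues⟩ hr

theorem zero_mem_vecValues (ξ : H₀) : 0 ∈ vecValues ξ (0 : AlgTensor C X Y) :=
  ⟨0, zero_mem (decompositions C X Y), map_zero _⟩

theorem add_mem_vecValues {ξ : H₀} {v w : AlgTensor C X Y} {r t : ℝ} (hr : r ∈ vecValues ξ v)
    (ht : t ∈ vecValues ξ w) : r + t ∈ vecValues ξ (v + w) := by
  obtain ⟨a, ha, rfl⟩ := hr
  obtain ⟨b, hb, rfl⟩ := ht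
  exact ⟨a + b, (decompositions C X Y).add_mem ha hb, map_add (vecForm ξ) _ _⟩

variable [NormedSpace ℂ X] [IsScalarTower ℂ C.toStarSubalgebra X]

theorem algTmul_complex_smul_left (a : ℂ) (x : X) (y : Y) :
    algTmul C (a • x) y = a • algTmul C x y :=
  (TensorProduct.smul_tmul' a x y).symm

theorem smul_mem_decompositions (a : ℂ) {d : AlgTensor C X Y × C.toStarSubalgebra}
    (hd : d ∈ decompositions C X Y) : (a • d.1, (‖a‖ : ℂ) • d.2) ∈ decompositions C X Y := by
  induction hd using AddSubmonoid.closure_induction with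
  | mem d hd =>
    obtain ⟨c, x, y, hc, rfl⟩ := hd
    have h := smul_algTmul_mem_decompositions hc (a • x) y
    rw [norm_smul, mul_assoc, Complex.ofReal_mul, mul_smul, algTmul_complex_smul_left,
      smul_comm c a] at h
    exact h
  | zero => simp [← Prod.zero_eq_mk]
  | add d e _ _ hd he => simpa using add_mem hd he

theorem smul_mem_vecValues {ξ : H₀} {v : AlgTensor C X Y} (a : ℂ) {r : ℝ}
    (hr : r ∈ vecValues ξ v) : ‖a‖ * r ∈ vecValues ξ (a • v) := by
  obtain ⟨s, hs, rfl⟩ := hr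
  refine ⟨(‖a‖ : ℂ) • s, smul_mem_decompositions a hs, ?_⟩
  rw [Complex.coe_smul]
  exact map_smul (vecForm ξ) ‖a‖ (s : H₀ →L[ℂ] H₀)

/-- The seminorm `v ↦ inf ⟪ξ, s ξ⟫`, where `s` runs over the total coefficients of the
decompositions of `v`. -/
def vecNorm (ξ : H₀) : Seminorm ℂ (AlgTensor C X Y) :=
  .ofSMulLE (fun v => sInf (vecValues ξ v))
    (le_antisymm (sInf_vecValues_le (zero_mem_vecValues ξ))
      (Real.sInf_nonneg fun _ => nonneg_of_mem_vecValues))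
    (fun v w => by
      have hbdd : ∀ u : AlgTensor C X Y, BddBelow (vecValues ξ u) :=
        fun u => ⟨0, fun _ => nonneg_of_mem_vecValues⟩
      rw [← csInf_add (vecValues_nonempty ξ v) (hbdd v) (vecValues_nonempty ξ w) (hbdd w)]
      refine csInf_le_csInf (hbdd _) ((vecValues_nonempty ξ v).add (vecValues_nonempty ξ w)) ?_
      rintro _ ⟨r, hr, t, ht, rfl⟩
      exact add_mem_vecValues hr ht)
    (fun a v => by
      rw [← smul_eq_mul, ← Real.sInf_smul_of_nonneg (norm_nonneg a)]
      refine le_csInf (vecValues_nonempty ξ v).smul_set ?_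
      rintro _ ⟨r, hr, rfl⟩
      exact sInf_vecValues_le (smul_mem_vecValues a hr))

theorem vecNorm_le (ξ : H₀) {v : AlgTensor C X Y} {s : C.toStarSubalgebra}
    (h : (v, s) ∈ decompositions C X Y) : vecNorm ξ v ≤ vecForm ξ (s : H₀ →L[ℂ] H₀) :=
  sInf_vecValues_le ⟨s, h, rfl⟩

theorem exists_vecForm_lt {ξ : H₀} {v : AlgTensor C X Y} {r : ℝ} (h : vecNorm ξ v < r) :
    ∃ s, (v, s) ∈ decompositions C X Y ∧ vecForm ξ (s : H₀ →L[ℂ] H₀) < r := by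
  obtain ⟨_, ⟨s, hs, rfl⟩, hsr⟩ := exists_lt_of_csInf_lt (vecValues_nonempty ξ v) h
  exact ⟨s, hs, hsr⟩

end Decompositions

section Commutant

variable {H₀ : Type u} [NormedAddCommGroup H₀] [InnerProductSpace ℂ H₀] [CompleteSpace H₀]
  {C : VonNeumannAlgebra H₀} [IsMulCommutative C.toStarSubalgebra]

theorem le_commutant : C.toStarSubalgebra ≤ C.commutant.toStarSubalgebra := fun c hc =>
  VonNeumannAlgebra.mem_commutant_iff.2 fun g hg =>
    congrArg Subtype.val (mul_comm (⟨g, hg⟩ : C.toStarSubalgebra) ⟨c, hc⟩)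

instance : Module C.toStarSubalgebra C.commutant.toStarSubalgebra :=
  Module.compHom _ (StarSubalgebra.inclusion (le_commutant (C := C))).toAlgHom.toRingHom

theorem isCNRM_commutant : IsCNRM C C.commutant.toStarSubalgebra :=
  ⟨(isClosed_carrier C.commutant).completeSpace_coe, H₀, H₀, _, _, _, _, _, _, ⟨{
    left := C.toStarSubalgebra.subtype
    right := C.toStarSubalgebra.subtype
    left_normal := isNormal_subtype C
    right_normal := isNormal_subtype C
    emb := C.commutant.toStarSubalgebra.toSubalgebra.toSubmodule.subtypeₗᵢ
    emb_left := fun _ _ => rfl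
    emb_right := fun c z => VonNeumannAlgebra.mem_commutant_iff.1 z.2 c c.2 }⟩⟩

theorem norm_abs_apply (a : C.toStarSubalgebra) (ξ : H₀) :
    ‖((CFC.abs a : C.toStarSubalgebra) : H₀ →L[ℂ] H₀) ξ‖ = ‖(a : H₀ →L[ℂ] H₀) ξ‖ := by
  have habs : star (CFC.abs a) * CFC.abs a = star a * a := by
    rw [(CFC.abs_nonneg a).isSelfAdjoint.star_eq, CFC.abs_mul_abs]
  rw [← sq_eq_sq₀ (norm_nonneg _) (norm_nonneg _), ← vecForm_star_mul_self,
    ← vecForm_star_mul_self]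
  exact congrArg (fun c : C.toStarSubalgebra => vecForm ξ (c : H₀ →L[ℂ] H₀)) habs

theorem vecForm_abs_star_mul_le (ξ : H₀) (b a : C.toStarSubalgebra) :
    vecForm ξ (CFC.abs (star b * a) : C.toStarSubalgebra) ≤
      ‖(b : H₀ →L[ℂ] H₀) ξ‖ * ‖(a : H₀ →L[ℂ] H₀) ξ‖ := by
  have : IsStarNormal b := ⟨mul_comm _ _⟩
  have habs : CFC.abs (star b * a) = star (CFC.abs b) * CFC.abs a := by
    rw [Commute.cfcAbs_mul_eq (Commute.all _ _) (Commute.all _ _), CFC.abs_star,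
      (CFC.abs_nonneg b).isSelfAdjoint.star_eq]
  rw [habs, ← norm_abs_apply b, ← norm_abs_apply a, vecForm_apply]
  refine (re_inner_le_norm (𝕜 := ℂ) _ _).trans' (le_of_eq ?_)
  exact congrArg Complex.re
    (ContinuousLinearMap.adjoint_inner_right (CFC.abs b : C.toStarSubalgebra).1 ξ _)

end Commutant

section OrbitMap

variable {H₀ : Type u} [NormedAddCommGroup H₀] [InnerProductSpace ℂ H₀] [CompleteSpace H₀]
  {C : VonNeumannAlgebra H₀}

variable (C) in
/-- The orbit map `a ↦ a ξ`. -/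
def orbitMap (ξ : H₀) : C.toStarSubalgebra →ₗ[ℂ] H₀ :=
  LinearMap.applyₗ ξ ∘ₗ ContinuousLinearMap.coeLM ℂ ∘ₗ
    C.toStarSubalgebra.toSubalgebra.toSubmodule.subtype

theorem rangeProjection_orbitMap_mul_comm (ξ : H₀) (c : C.toStarSubalgebra) :
    rangeProjection (orbitMap C ξ) * (c : H₀ →L[ℂ] H₀) = c * rangeProjection (orbitMap C ξ) := by
  have hmem : rangeProjection (orbitMap C ξ) ∈ C.commutant := by
    refine (VonNeumannAlgebra.IsStarProjection.mem_iff isStarProjection_rangeProjection _).2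
      fun y hy => ?_
    rw [VonNeumannAlgebra.commutant_commutant] at hy
    rw [rangeProjection, Submodule.range_starProjection, Module.End.mem_invtSubmodule]
    have hmaps : Set.MapsTo y (LinearMap.range (orbitMap C ξ))
        (LinearMap.range (orbitMap C ξ)) := by
      rintro _ ⟨a, rfl⟩
      exact ⟨⟨y, hy⟩ * a, rfl⟩
    exact fun ζ hζ => hmaps.closure y.continuous hζ
  exact (VonNeumannAlgebra.mem_commutant_iff.1 hmem c c.2).symm

end OrbitMap

section RadonNikodym

variable {H₀ : Type u} [NormedAddCommGroup H₀] [InnerProductSpace ℂ H₀] [CompleteSpace H₀]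
  {C : VonNeumannAlgebra H₀} [IsMulCommutative C.toStarSubalgebra]
  {X Y : Type u}
  [NormedAddCommGroup X] [NormedSpace ℂ X] [Module C.toStarSubalgebra X]
  [IsScalarTower ℂ C.toStarSubalgebra X]
  [NormedAddCommGroup Y] [Module C.toStarSubalgebra Y]
  {ξ : H₀} {θ : AlgTensor C X Y →ₗ[ℂ] ℂ}

-- For positive coefficients the bound comes from the definition of `vecNorm`;
-- `norm_apply_le_apply_abs` extends it to all of `C`.
theorem norm_apply_smul_algTmul_le (hθ : ∀ v, ‖θ v‖ ≤ vecNorm ξ v) (b a : C.toStarSubalgebra)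
    (x : X) (y : Y) : ‖θ ((star b * a) • algTmul C x y)‖ ≤
      ‖x‖ * ‖y‖ * ‖(b : H₀ →L[ℂ] H₀) ξ‖ * ‖(a : H₀ →L[ℂ] H₀) ξ‖ := by
  let φ : C.toStarSubalgebra →ₗ[ℂ] ℂ :=
    ((‖x‖ * ‖y‖ : ℝ) : ℂ) • (innerₛₗ ℂ ξ ∘ₗ orbitMap C ξ)
  have hφ : ∀ c, (φ c).re = ‖x‖ * ‖y‖ * vecForm ξ (c : H₀ →L[ℂ] H₀) := fun c =>
    Complex.re_ofReal_mul _ _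
  have hle : ∀ c : C.toStarSubalgebra, 0 ≤ c → ‖θ (c • algTmul C x y)‖ ≤ (φ c).re :=
    fun c hc => by
      refine ((hθ _).trans (vecNorm_le ξ (smul_algTmul_mem_decompositions hc x y))).trans_eq ?_
      rw [hφ, Complex.coe_smul]
      exact map_smul (vecForm ξ) (‖x‖ * ‖y‖) (c : H₀ →L[ℂ] H₀)
  have : IsStarNormal (star b * a) := ⟨mul_comm _ _⟩
  calc ‖θ ((star b * a) • algTmul C x y)‖ ≤ (φ (CFC.abs (star b * a))).re :=
        norm_apply_le_apply_abs (θ := θ ∘ₗ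
          (LinearMap.toSpanSingleton C.toStarSubalgebra _ (algTmul C x y)).restrictScalars ℂ) hle _
    _ ≤ ‖x‖ * ‖y‖ * (‖(b : H₀ →L[ℂ] H₀) ξ‖ * ‖(a : H₀ →L[ℂ] H₀) ξ‖) := by
        rw [hφ]
        exact mul_le_mul_of_nonneg_left (vecForm_abs_star_mul_le ξ b a) (by positivity)
    _ = ‖x‖ * ‖y‖ * ‖(b : H₀ →L[ℂ] H₀) ξ‖ * ‖(a : H₀ →L[ℂ] H₀) ξ‖ := (mul_assoc _ _ _).symm

variable (ξ θ) in
/-- `T` is the Radon–Nikodym derivative of the functional `a ↦ θ (a • v)` on `C` with respect to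
the vector functional of `ξ`. It is normalised to live on the closure of the orbit `C ξ`. -/
structure IsDensity (v : AlgTensor C X Y) (T : H₀ →L[ℂ] H₀) : Prop where
  compress : rangeProjection (orbitMap C ξ) * T * rangeProjection (orbitMap C ξ) = T
  inner_apply : ∀ b a : C.toStarSubalgebra,
    ⟪orbitMap C ξ b, T (orbitMap C ξ a)⟫_ℂ = θ ((star b * a) • v)

namespace IsDensity

variable {v w : AlgTensor C X Y} {S T : H₀ →L[ℂ] H₀}

theorem unique (hS : IsDensity ξ θ v S) (hT : IsDensity ξ θ v T) : S = T :=
  eq_of_inner_apply_eq hS.compress hT.compress fun b a => by rw [hS.inner_apply, hT.inner_apply]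

theorem add (hS : IsDensity ξ θ v S) (hT : IsDensity ξ θ w T) : IsDensity ξ θ (v + w) (S + T) where
  compress := by rw [mul_add, add_mul, hS.compress, hT.compress]
  inner_apply b a := by
    rw [add_apply, inner_add_right, hS.inner_apply, hT.inner_apply, smul_add, map_add]

theorem smul (hT : IsDensity ξ θ v T) (c : C.toStarSubalgebra) : IsDensity ξ θ (c • v) (c * T) where
  compress := by
    rw [← mul_assoc, rangeProjection_orbitMap_mul_comm, mul_assoc, mul_assoc, ← mul_assoc _ T,
      hT.compress]
  inner_apply b a := by
    have h := hT.inner_apply (star c * b) a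
    rw [star_mul, star_star, mul_right_comm, mul_smul] at h
    exact (ContinuousLinearMap.adjoint_inner_left (c : H₀ →L[ℂ] H₀) _ _).symm.trans h

theorem mul_eq_mul (hT : IsDensity ξ θ v T) (c : C.toStarSubalgebra) :
    (c : H₀ →L[ℂ] H₀) * T = T * c := by
  refine (hT.smul c).unique ⟨?_, fun b a => ?_⟩
  · rw [mul_assoc, mul_assoc, ← rangeProjection_orbitMap_mul_comm, ← mul_assoc T, ← mul_assoc,
      ← mul_assoc, hT.compress]
  · have h := hT.inner_apply b (c * a)
    rwa [← mul_assoc, mul_right_comm, mul_smul] at h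

theorem inner_self (hT : IsDensity ξ θ v T) : ⟪ξ, T ξ⟫_ℂ = θ v := by
  have h := hT.inner_apply 1 1
  rwa [star_one, one_mul, one_smul] at h

end IsDensity

theorem exists_isDensity_algTmul (hθ : ∀ v, ‖θ v‖ ≤ vecNorm ξ v) (x : X) (y : Y) :
    ∃ T, ‖T‖ ≤ ‖x‖ * ‖y‖ ∧ IsDensity ξ θ (algTmul C x y) T := by
  let B : C.toStarSubalgebra →ₗ⋆[ℂ] C.toStarSubalgebra →ₗ[ℂ] ℂ :=
    LinearMap.mk₂'ₛₗ _ _ (fun b a => θ ((star b * a) • algTmul C x y))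
      (fun b b' a => by rw [star_add, add_mul, add_smul, map_add])
      (fun k b a => by rw [star_smul, smul_mul_assoc, smul_assoc, map_smul]; rfl)
      (fun b a a' => by rw [mul_add, add_smul, map_add])
      (fun k b a => by rw [mul_smul_comm, smul_assoc, map_smul]; rfl)
  obtain ⟨T, hTn, hT, hB⟩ := exists_inner_apply_eq (j := orbitMap C ξ) B (m := ‖x‖ * ‖y‖)
    (by positivity) fun b a => norm_apply_smul_algTmul_le hθ b a x y
  exact ⟨T, hTn, hT, hB⟩

theorem exists_isDensity (hθ : ∀ v, ‖θ v‖ ≤ vecNorm ξ v) (v : AlgTensor C X Y) :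
    ∃ T, IsDensity ξ θ v T := by
  induction v using algTensor_induction with
  | zero => exact ⟨0, by simp, by simp⟩
  | tmul x y =>
    obtain ⟨T, -, hT⟩ := exists_isDensity_algTmul hθ x y
    exact ⟨T, hT⟩
  | add v w hv hw =>
    obtain ⟨S, hS⟩ := hv
    obtain ⟨T, hT⟩ := hw
    exact ⟨S + T, hS.add hT⟩

theorem exists_commutant_map (hθ : ∀ v, ‖θ v‖ ≤ vecNorm ξ v) :
    ∃ R : AlgTensor C X Y →ₗ[C.toStarSubalgebra] C.commutant.toStarSubalgebra,
      (∀ x y, ‖R (algTmul C x y)‖ ≤ ‖x‖ * ‖y‖) ∧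
      ∀ v, ⟪ξ, (R v : H₀ →L[ℂ] H₀) ξ⟫_ℂ = θ v := by
  choose T hT using exists_isDensity hθ
  refine ⟨{
    toFun v := ⟨T v, VonNeumannAlgebra.mem_commutant_iff.2 fun c hc => (hT v).mul_eq_mul ⟨c, hc⟩⟩
    map_add' v w := Subtype.ext ((hT _).unique ((hT v).add (hT w)))
    map_smul' c v := Subtype.ext ((hT _).unique ((hT v).smul c)) },
    fun x y => ?_, fun v => (hT v).inner_self⟩
  obtain ⟨S, hSn, hS⟩ := exists_isDensity_algTmul hθ x y
  exact (congrArg norm ((hT _).unique hS)).trans_le hSn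

variable [NormedSpace ℂ Y] [IsScalarTower ℂ C.toStarSubalgebra Y]

theorem norm_apply_le_nu {Z : Type u} [NormedAddCommGroup Z] [NormedSpace ℂ Z]
    [Module C.toStarSubalgebra Z] (hZ : IsCNRM C Z) (R : AlgTensor C X Y →ₗ[C.toStarSubalgebra] Z)
    (hR : ∀ x y, ‖R (algTmul C x y)‖ ≤ ‖x‖ * ‖y‖) (w : AlgTensor C X Y) : ‖R w‖ ≤ nu C w := by
  refine le_csSup (nuSet_bddAbove C w)
    ⟨Z, _, _, _, (algTmul C).compr₂ R, hZ, hR, congrArg norm ?_⟩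
  exact (LinearMap.congr_fun (TensorProduct.lift_mk_compr₂ (f := R)) w).symm

theorem vecNorm_le_nu (ξ : H₀) (w : AlgTensor C X Y) : vecNorm ξ w ≤ nu C w * ‖ξ‖ ^ 2 := by
  obtain ⟨θ, hθ, hθw⟩ := exists_linearMap_le_seminorm (vecNorm ξ) w
  obtain ⟨R, hR, hRθ⟩ := exists_commutant_map hθ
  calc vecNorm ξ w = vecForm ξ (R w : H₀ →L[ℂ] H₀) := by
        rw [vecForm_apply, hRθ, hθw, Complex.ofReal_re]
    _ ≤ ‖R w‖ * ‖ξ‖ ^ 2 := vecForm_le_norm ξ _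
    _ ≤ nu C w * ‖ξ‖ ^ 2 := by gcongr; exact norm_apply_le_nu isCNRM_commutant R hR w

theorem exists_projection_mul_le {v : AlgTensor C X Y} {r : ℝ} (hr : nu C v < r)
    {q : C.toStarSubalgebra} (hq : IsStarProjection q) (hq0 : q ≠ 0) :
    ∃ p s : C.toStarSubalgebra, IsStarProjection p ∧ p ≠ 0 ∧ p * q = p ∧
      (v, s) ∈ decompositions C X Y ∧ p * s ≤ (r : ℂ) • p := by
  obtain ⟨ζ, hζ⟩ : ∃ ζ, (q : H₀ →L[ℂ] H₀) ζ ≠ 0 := by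
    by_contra! h
    exact hq0 (Subtype.ext (ContinuousLinearMap.ext h))
  have hqζ : (q : H₀ →L[ℂ] H₀) ((q : H₀ →L[ℂ] H₀) ζ) = (q : H₀ →L[ℂ] H₀) ζ :=
    congrArg (fun T : C.toStarSubalgebra => (T : H₀ →L[ℂ] H₀) ζ) hq.1
  have hlt : vecNorm ((q : H₀ →L[ℂ] H₀) ζ) v < r * ‖(q : H₀ →L[ℂ] H₀) ζ‖ ^ 2 :=
    (vecNorm_le_nu _ v).trans_lt
      (mul_lt_mul_of_pos_right hr (pow_pos (norm_pos_iff.2 hζ) 2))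
  obtain ⟨s, hs, hsr⟩ := exists_vecForm_lt hlt
  obtain ⟨p, hp, hp0, hpq, hps⟩ :=
    exists_projection_le (.of_nonneg (nonneg_of_mem_decompositions hs)) hq hqζ hsr
  exact ⟨p, s, hp, hp0, hpq, hs, hps⟩

end RadonNikodym

section StrongHull

theorem HasWeakStarSum.comp_right {J K H L : Type u} [NormedAddCommGroup K]
    [InnerProductSpace ℂ K] [NormedAddCommGroup H] [InnerProductSpace ℂ H]
    [NormedAddCommGroup L] [InnerProductSpace ℂ L] {f : J → K →L[ℂ] H} {T : K →L[ℂ] H}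
    (hT : HasWeakStarSum f T) (R : L →L[ℂ] K) :
    HasWeakStarSum (fun j => f j ∘L R) (T ∘L R) := by
  intro ξ η hξ hη
  have hRξ : Summable fun n => ‖R (ξ n)‖ ^ 2 :=
    .of_nonneg_of_le (fun n => by positivity) (fun n => by
      rw [← mul_pow]
      gcongr
      exact R.le_opNorm _) (hξ.mul_left (‖R‖ ^ 2))
  exact hT (fun n => R (ξ n)) η hRξ hη

variable {H₀ : Type u} [NormedAddCommGroup H₀] [InnerProductSpace ℂ H₀] [CompleteSpace H₀]
  {C : VonNeumannAlgebra H₀} {K H : Type u}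
  [NormedAddCommGroup K] [InnerProductSpace ℂ K]
  [NormedAddCommGroup H] [InnerProductSpace ℂ H] [CompleteSpace H]
  {π : C.toStarSubalgebra →⋆ₐ[ℂ] (H →L[ℂ] H)} {S T : K →L[ℂ] H} {𝒮 : Submodule ℂ (K →L[ℂ] H)}

theorem rep_mul_comp (π : C.toStarSubalgebra →⋆ₐ[ℂ] (H →L[ℂ] H)) (a b : C.toStarSubalgebra)
    (T : K →L[ℂ] H) : π (a * b) ∘L T = π a ∘L (π b ∘L T) := by
  rw [map_mul]
  rfl

theorem norm_rep_projection_comp_le (π : C.toStarSubalgebra →⋆ₐ[ℂ] (H →L[ℂ] H))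
    {p : C.toStarSubalgebra} (hp : IsStarProjection p) (T : K →L[ℂ] H) : ‖π p ∘L T‖ ≤ ‖T‖ :=
  (ContinuousLinearMap.opNorm_comp_le _ _).trans
    (mul_le_of_le_one_left (norm_nonneg _) (hp.map π).norm_le)

theorem norm_rep_projection_comp_mono (π : C.toStarSubalgebra →⋆ₐ[ℂ] (H →L[ℂ] H))
    {p q : C.toStarSubalgebra} (hp : IsStarProjection p) (hpq : p * q = p) (T : K →L[ℂ] H) :
    ‖π p ∘L T‖ ≤ ‖π q ∘L T‖ := by
  conv_lhs => rw [← hpq, rep_mul_comp]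
  exact norm_rep_projection_comp_le π hp _

theorem HasWeakStarSum.rep_comp_eq {J : Type u} {p : J → C.toStarSubalgebra} {z : J → K →L[ℂ] H}
    (horth : Pairwise fun i j => p i * p j = 0) (hT : HasWeakStarSum (fun j => π (p j) ∘L z j) T)
    {q : C.toStarSubalgebra} {j : J} (hq : q * p j = q) : π q ∘L T = π q ∘L z j := by
  have hzero : ∀ i ≠ j, q * p i = 0 := fun i hij => by
    rw [← hq, mul_assoc, horth hij.symm, mul_zero]
  refine (hT.comp_left (π q)).unique (hasWeakStarSum_of_summable_norm ?_ ?_)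
  · refine summable_of_ne_finset_zero (s := {j}) fun i hi => ?_
    rw [← rep_mul_comp, hzero i (mt Finset.mem_singleton.2 hi), map_zero,
      ContinuousLinearMap.zero_comp, norm_zero]
  · convert hasSum_single j fun i hij => ?_ using 1
    · rw [← rep_mul_comp, hq]
    · rw [← rep_mul_comp, hzero i hij, map_zero, ContinuousLinearMap.zero_comp]

theorem HasWeakStarSum.rep_comp_eq_zero {J : Type u} {p : J → C.toStarSubalgebra}
    {z : J → K →L[ℂ] H} (hT : HasWeakStarSum (fun j => π (p j) ∘L z j) T)
    {q : C.toStarSubalgebra} (hq : ∀ j, q * p j = 0) : π q ∘L T = 0 := by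
  have hterm : ∀ j, π q ∘L (π (p j) ∘L z j) = 0 := fun j => by
    rw [← rep_mul_comp, hq, map_zero, ContinuousLinearMap.zero_comp]
  refine (hT.comp_left (π q)).unique ?_
  simp only [hterm]
  exact hasWeakStarSum_of_summable_norm (by simp) hasSum_zero

variable (π 𝒮) in
/-- `T` can be approximated in norm by elements of `𝒮` after cutting down by suitable projections,
below every nonzero projection of `C`. Unlike norm approximation, this passes to weak* sums
`∑ j, p j • z j` over orthogonal projections. -/
def IsLocalLimit (T : K →L[ℂ] H) : Prop :=
  ∀ ε > 0, ∀ q : C.toStarSubalgebra, IsStarProjection q → q ≠ 0 →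
    ∃ p : C.toStarSubalgebra, IsStarProjection p ∧ p ≠ 0 ∧ p * q = p ∧
      ∃ z ∈ 𝒮, ‖π p ∘L (T - z)‖ ≤ ε

namespace IsLocalLimit

theorem of_mem_closure (h : ∀ ε > 0, ∃ S, IsLocalLimit π 𝒮 S ∧ ‖T - S‖ ≤ ε) :
    IsLocalLimit π 𝒮 T := fun ε hε q hq hq0 => by
  obtain ⟨S, hS, hTS⟩ := h (ε / 2) (half_pos hε)
  obtain ⟨p, hp, hp0, hpq, z, hz, hpz⟩ := hS (ε / 2) (half_pos hε) q hq hq0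
  refine ⟨p, hp, hp0, hpq, z, hz, ?_⟩
  calc ‖π p ∘L (T - z)‖ = ‖π p ∘L (T - S) + π p ∘L (S - z)‖ := by
        rw [← ContinuousLinearMap.comp_add, sub_add_sub_cancel]
    _ ≤ ‖π p ∘L (T - S)‖ + ‖π p ∘L (S - z)‖ := norm_add_le _ _
    _ ≤ ε / 2 + ε / 2 := add_le_add ((norm_rep_projection_comp_le π hp _).trans hTS) hpz
    _ = ε := add_halves ε

theorem of_mem (hT : T ∈ 𝒮) : IsLocalLimit π 𝒮 T := fun ε hε q hq hq0 =>
  ⟨q, hq, hq0, hq.1, T, hT, by simpa using hε.le⟩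

theorem add (hS : IsLocalLimit π 𝒮 S) (hT : IsLocalLimit π 𝒮 T) : IsLocalLimit π 𝒮 (S + T) := by
  intro ε hε q hq hq0
  obtain ⟨p, hp, hp0, hpq, y, hy, hpy⟩ := hS (ε / 2) (half_pos hε) q hq hq0
  obtain ⟨r, hr, hr0, hrp, z, hz, hrz⟩ := hT (ε / 2) (half_pos hε) p hp hp0
  refine ⟨r, hr, hr0, by rw [← hrp, mul_assoc, hpq], y + z, 𝒮.add_mem hy hz, ?_⟩
  calc ‖π r ∘L (S + T - (y + z))‖ = ‖π r ∘L (S - y) + π r ∘L (T - z)‖ := by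
        rw [← ContinuousLinearMap.comp_add, add_sub_add_comm]
    _ ≤ ‖π r ∘L (S - y)‖ + ‖π r ∘L (T - z)‖ := norm_add_le _ _
    _ ≤ ε / 2 + ε / 2 := add_le_add ((norm_rep_projection_comp_mono π hr hrp _).trans hpy) hrz
    _ = ε := add_halves ε

theorem map (hT : IsLocalLimit π 𝒮 T) {f : (K →L[ℂ] H) → K →L[ℂ] H} {M : ℝ} (hM : 0 ≤ M)
    (hsub : ∀ R S, f (R - S) = f R - f S) (hf : ∀ c R, π c ∘L f R = f (π c ∘L R))
    (hfM : ∀ R, ‖f R‖ ≤ M * ‖R‖) (hf𝒮 : ∀ z ∈ 𝒮, f z ∈ 𝒮) : IsLocalLimit π 𝒮 (f T) := by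
  intro ε hε q hq hq0
  obtain ⟨p, hp, hp0, hpq, z, hz, hpz⟩ := hT (ε / (M + 1)) (by positivity) q hq hq0
  refine ⟨p, hp, hp0, hpq, f z, hf𝒮 z hz, ?_⟩
  calc ‖π p ∘L (f T - f z)‖ ≤ M * ‖π p ∘L (T - z)‖ := by
        rw [← hsub, hf]
        exact hfM _
    _ ≤ (M + 1) * (ε / (M + 1)) := by gcongr; linarith
    _ = ε := by field_simp

variable [IsMulCommutative C.toStarSubalgebra]

theorem of_hasWeakStarSum {J : Type u} {p : J → C.toStarSubalgebra} {z : J → K →L[ℂ] H}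
    (hp : ∀ j, IsStarProjection (p j)) (horth : Pairwise fun i j => p i * p j = 0)
    (hz : ∀ j, IsLocalLimit π 𝒮 (z j)) (hT : HasWeakStarSum (fun j => π (p j) ∘L z j) T) :
    IsLocalLimit π 𝒮 T := by
  intro ε hε q hq hq0
  by_cases h : ∃ j, q * p j ≠ 0
  · obtain ⟨j, hj⟩ := h
    obtain ⟨e, he, he0, heq, v, hv, hev⟩ := hz j ε hε (q * p j) (hq.mul (hp j) (mul_comm _ _)) hj
    have hep : e * p j = e := by rw [← heq, mul_assoc, mul_assoc, (hp j).1]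
    have heq' : e * q = e := by rw [← heq, mul_comm q, mul_assoc, mul_assoc, hq.1]
    refine ⟨e, he, he0, heq', v, hv, ?_⟩
    rwa [ContinuousLinearMap.comp_sub, hT.rep_comp_eq horth hep, ← ContinuousLinearMap.comp_sub]
  · refine ⟨q, hq, hq0, hq.1, 0, 𝒮.zero_mem, ?_⟩
    rw [sub_zero, hT.rep_comp_eq_zero (by simpa using h), norm_zero]
    exact hε.le

end IsLocalLimit

theorem rep_comp_comm [IsMulCommutative C.toStarSubalgebra]
    (π : C.toStarSubalgebra →⋆ₐ[ℂ] (H →L[ℂ] H)) (c d : C.toStarSubalgebra)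
    (T : K →L[ℂ] H) : π c ∘L (π d ∘L T) = π d ∘L (π c ∘L T) := by
  rw [← rep_mul_comp, mul_comm, rep_mul_comp]

variable [CompleteSpace K] {σ : C.toStarSubalgebra →⋆ₐ[ℂ] (K →L[ℂ] K)}

/-- The central local limits of `𝒮`: a concrete strong bimodule containing a given central
bimodule `𝒮`. -/
def localHull (π : C.toStarSubalgebra →⋆ₐ[ℂ] (H →L[ℂ] H))
    (σ : C.toStarSubalgebra →⋆ₐ[ℂ] (K →L[ℂ] K)) (𝒮 : Submodule ℂ (K →L[ℂ] H)) :
    Submodule ℂ (K →L[ℂ] H) where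
  carrier := {T | (∀ c, π c ∘L T = T ∘L σ c) ∧ IsLocalLimit π 𝒮 T}
  zero_mem' := ⟨fun c => by simp, .of_mem 𝒮.zero_mem⟩
  add_mem' hS hT :=
    ⟨fun c => by rw [ContinuousLinearMap.comp_add, ContinuousLinearMap.add_comp, hS.1, hT.1],
      hS.2.add hT.2⟩
  smul_mem' k T hT :=
    ⟨fun c => by rw [ContinuousLinearMap.comp_smul, ContinuousLinearMap.smul_comp, hT.1],
      hT.2.map (f := (k • ·)) (norm_nonneg k) (smul_sub k)
        (fun c R => (π c).comp_smul k R) (fun R => (norm_smul k R).le)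
        fun z hz => 𝒮.smul_mem k hz⟩

theorem IsStrong.sInf {𝒲 : Set (Submodule ℂ (K →L[ℂ] H))} (hne : 𝒲.Nonempty)
    (h : ∀ W ∈ 𝒲, IsStrong π σ W) : IsStrong π σ (sInf 𝒲) where
  isClosed := by
    rw [Submodule.coe_sInf]
    exact isClosed_biInter fun W hW => (h W hW).isClosed
  smul_mem c T hT := Submodule.mem_sInf.2 fun W hW =>
    (h W hW).smul_mem c T (Submodule.mem_sInf.1 hT W hW)
  central c T hT := hne.elim fun W hW => (h W hW).central c T (Submodule.mem_sInf.1 hT W hW)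
  sum_mem J p z hp horth hz hM T hT := Submodule.mem_sInf.2 fun W hW =>
    (h W hW).sum_mem J p z hp horth (fun j => Submodule.mem_sInf.1 (hz j) W hW) hM T hT

variable {Z : Type u} [NormedAddCommGroup Z] [NormedSpace ℂ Z] [Module C.toStarSubalgebra Z]

theorem emb_mem_localHull_range (E : NormalEmbedding C Z K H) (z : Z) :
    E.emb z ∈ localHull E.left E.right (LinearMap.range E.emb.toLinearMap) :=
  ⟨fun c => (E.emb_left c z).symm.trans (E.emb_right c z), .of_mem ⟨z, rfl⟩⟩

variable [IsMulCommutative C.toStarSubalgebra]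

theorem isStrong_localHull (h𝒮 : ∀ (c : C.toStarSubalgebra), ∀ z ∈ 𝒮, π c ∘L z ∈ 𝒮) :
    IsStrong π σ (localHull π σ 𝒮) where
  isClosed := isClosed_of_closure_subset fun T hT =>
    ⟨fun c => closure_minimal (t := {T | π c ∘L T = T ∘L σ c}) (fun S hS => hS.1 c)
        (isClosed_eq (by fun_prop) (by fun_prop)) hT,
      .of_mem_closure fun ε hε => by
        obtain ⟨S, hS, hd⟩ := Metric.mem_closure_iff.1 hT ε hε
        exact ⟨S, hS.2, (dist_eq_norm T S).symm.trans_le hd.le⟩⟩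
  smul_mem c T hT :=
    ⟨fun d => by rw [rep_comp_comm, hT.1 d, ContinuousLinearMap.comp_assoc],
      hT.2.map (f := (π c ∘L ·)) (norm_nonneg (π c)) ((π c).comp_sub)
        (fun d R => rep_comp_comm π d c R) (fun R => ContinuousLinearMap.opNorm_comp_le _ _)
        (h𝒮 c)⟩
  central c T hT := hT.1 c
  sum_mem J p z hp horth hz _ T hT := by
    refine ⟨fun c => (hT.comp_left (π c)).unique ?_,
      .of_hasWeakStarSum hp horth (fun j => (hz j).2) hT⟩
    refine (funext fun j => ?_ : _ = fun j => π c ∘L (π (p j) ∘L z j)) ▸ hT.comp_right (σ c)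
    rw [rep_comp_comm, (hz j).1 c, ContinuousLinearMap.comp_assoc]

theorem isStrong_localHull_range (E : NormalEmbedding C Z K H) :
    IsStrong E.left E.right (localHull E.left E.right (LinearMap.range E.emb.toLinearMap)) :=
  isStrong_localHull (by
    rintro c _ ⟨z, rfl⟩
    exact ⟨c • z, E.emb_left c z⟩)

theorem isLeast_strongHull (E : NormalEmbedding C Z K H) :
    IsLeast {W | IsStrong E.left E.right W ∧ ∀ z, E.emb z ∈ W} E.strongHull :=
  ⟨⟨IsStrong.sInf ⟨_, isStrong_localHull_range E, emb_mem_localHull_range E⟩ fun _ hW => hW.1,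
    fun z => Submodule.mem_sInf.2 fun _ hW => hW.2 z⟩, fun _ hW => sInf_le hW⟩

theorem isLocalLimit_of_mem_strongHull {E : NormalEmbedding C Z K H} {w : K →L[ℂ] H}
    (hw : w ∈ E.strongHull) : IsLocalLimit E.left (LinearMap.range E.emb.toLinearMap) w :=
  ((isLeast_strongHull E).2 ⟨isStrong_localHull_range E, emb_mem_localHull_range E⟩ hw).2

end StrongHull

section Series

variable {V S : Type*} [NormedAddCommGroup V] [NormedAddCommGroup S] {W : AddSubgroup V}
  {R : V → S → Prop} {w : V}

theorem exists_seq_of_approx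
    (step : ∀ δ > 0, ∀ u ∈ W, ∃ v ∈ W, ∃ s, R v s ∧ ‖s‖ ≤ ‖u‖ + δ ∧ ‖u - v‖ ≤ δ)
    (hw : w ∈ W) {e : ℕ → ℝ} (he : ∀ n, 0 < e n) :
    ∃ (v : ℕ → V) (s : ℕ → S), ∀ n, R (v n) (s n) ∧
      ‖s n‖ ≤ ‖w - ∑ i ∈ Finset.range n, v i‖ + e n ∧
      ‖w - ∑ i ∈ Finset.range (n + 1), v i‖ ≤ e n := by
  have step' : ∀ (n : ℕ) (u : W), ∃ (v : W) (s : S), R v s ∧ ‖s‖ ≤ ‖(u : V)‖ + e n ∧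
      ‖(u : V) - v‖ ≤ e n := fun n u => by
    obtain ⟨v, hv, h⟩ := step (e n) (he n) u u.2
    exact ⟨⟨v, hv⟩, h⟩
  choose f g hfg hg hf using step'
  let u : ℕ → W := fun n => Nat.rec (motive := fun _ => W) ⟨w, hw⟩ (fun n v => v - f n v) n
  have hu (n : ℕ) : ((u n : W) : V) = w - ∑ i ∈ Finset.range n, ((f i (u i) : W) : V) := by
    induction n with
    | zero => rw [Finset.range_zero, Finset.sum_empty, sub_zero]; rfl
    | succ n ih =>
      have hsucc : ((u (n + 1) : W) : V) = u n - f n (u n) := rfl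
      rw [hsucc, Finset.sum_range_succ, ← sub_sub, ← ih]
  refine ⟨fun n => f n (u n), fun n => g n (u n), fun n => ⟨hfg n (u n), ?_, ?_⟩⟩
  · exact hu n ▸ hg n (u n)
  · rw [Finset.sum_range_succ, ← sub_sub, ← hu]
    exact hf n (u n)

variable [CompleteSpace V] [CompleteSpace S]

theorem exists_series_of_approx (hR : ∀ v s, R v s → ‖v‖ ≤ ‖s‖)
    (step : ∀ δ > 0, ∀ u ∈ W, ∃ v ∈ W, ∃ s, R v s ∧ ‖s‖ ≤ ‖u‖ + δ ∧ ‖u - v‖ ≤ δ)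
    (hw : w ∈ W) {ε : ℝ} (hε : 0 < ε) :
    ∃ (v : ℕ → V) (s : ℕ → S) (s₀ : S), (∀ n, R (v n) (s n)) ∧
      HasSum v w ∧ (Summable fun n => ‖s n‖) ∧ HasSum s s₀ ∧ ‖s₀‖ ≤ ‖w‖ + ε := by
  let e : ℕ → ℝ := fun n => ε / 4 * (1 / 2) ^ n
  have he : HasSum e (ε / 2) := by
    have := hasSum_geometric_two.mul_left (ε / 4)
    rwa [show ε / 4 * 2 = ε / 2 by ring] at this
  obtain ⟨v, s, h⟩ := exists_seq_of_approx step hw (e := e) fun n => by positivity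
  let d : ℕ → ℝ := fun n => Nat.casesOn n ‖w‖ e
  have hd : HasSum d (‖w‖ + ε / 2) := HasSum.zero_add (f := d) he
  have hdw : ∀ n, ‖w - ∑ i ∈ Finset.range n, v i‖ ≤ d n := fun n => by
    cases n with
    | zero => simp [d]
    | succ n => exact (h n).2.2
  have hsd : ∀ n, ‖s n‖ ≤ d n + e n := fun n => (h n).2.1.trans (by gcongr; exact hdw n)
  have hde : HasSum (fun n => d n + e n) (‖w‖ + ε) := by
    simpa only [add_assoc, add_halves] using hd.add he
  have hs : Summable fun n => ‖s n‖ :=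
    .of_nonneg_of_le (fun n => norm_nonneg _) hsd hde.summable
  have hv : Summable fun n => ‖v n‖ :=
    .of_nonneg_of_le (fun n => norm_nonneg _) (fun n => hR _ _ (h n).1) hs
  have hvw : HasSum v w := by
    rw [hv.of_norm.hasSum_iff_tendsto_nat]
    simpa using (squeeze_zero_norm hdw hd.summable.tendsto_atTop_zero).const_sub w
  exact ⟨v, s, _, fun n => (h n).1, hvw, hs, hs.of_norm.hasSum, tsum_of_norm_bounded hde hsd⟩

end Series

section Representations

theorem hasWeakStarSum_fintype {J K H : Type u} [Fintype J] [NormedAddCommGroup K]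
    [InnerProductSpace ℂ K] [NormedAddCommGroup H] [InnerProductSpace ℂ H] (f : J → K →L[ℂ] H) :
    HasWeakStarSum f (∑ j, f j) :=
  hasWeakStarSum_of_summable_norm (hasSum_fintype _).summable (hasSum_fintype f)

theorem hasWeakStarSum_ulift {K H : Type u} [NormedAddCommGroup K] [InnerProductSpace ℂ K]
    [NormedAddCommGroup H] [InnerProductSpace ℂ H] {f : ℕ → K →L[ℂ] H} {T : K →L[ℂ] H}
    (hf : Summable fun n => ‖f n‖) (hT : HasSum f T) :
    HasWeakStarSum (fun n : ULift.{u} ℕ => f n.down) T :=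
  hasWeakStarSum_of_summable_norm (Equiv.ulift.summable_iff.2 hf) (Equiv.ulift.hasSum_iff.2 hT)

theorem exists_norm_le_one_smul_eq {V : Type*} [NormedAddCommGroup V] [NormedSpace ℂ V] (v : V) :
    ∃ u : V, ‖u‖ ≤ 1 ∧ (‖v‖ : ℂ) • u = v := by
  refine ⟨(‖v‖ : ℂ)⁻¹ • v, ?_, ?_⟩
  · simpa [norm_smul] using inv_mul_le_one (a := ‖v‖)
  · rcases eq_or_ne v 0 with rfl | hv
    · simp
    · exact smul_inv_smul₀ (by simpa using hv) v

variable {H₀ : Type u} [NormedAddCommGroup H₀] [InnerProductSpace ℂ H₀] [CompleteSpace H₀]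
  {C : VonNeumannAlgebra H₀} [IsMulCommutative C.toStarSubalgebra]
  {X Y : Type u}
  [NormedAddCommGroup X] [NormedSpace ℂ X] [Module C.toStarSubalgebra X]
  [IsScalarTower ℂ C.toStarSubalgebra X]
  [NormedAddCommGroup Y] [NormedSpace ℂ Y] [Module C.toStarSubalgebra Y]
  [IsScalarTower ℂ C.toStarSubalgebra Y]

theorem algTmul_complex_smul_right (a : ℂ) (x : X) (y : Y) :
    algTmul C x (a • y) = a • algTmul C x y := by
  rw [← IsScalarTower.algebraMap_smul C.toStarSubalgebra a y, map_smul,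
    IsScalarTower.algebraMap_smul]

theorem norm_coe_algTensor (v : AlgTensor C X Y) : ‖(v : NuTensor C X Y)‖ = nu C v :=
  UniformSpace.Completion.norm_coe v

theorem coe_smul_algTensor (c : C.toStarSubalgebra) (v : AlgTensor C X Y) :
    ((c • v : AlgTensor C X Y) : NuTensor C X Y) = c • (v : NuTensor C X Y) :=
  UniformSpace.Completion.coe_smul c v

theorem norm_nuTmul_le_one {x : X} {y : Y} (hx : ‖x‖ ≤ 1) (hy : ‖y‖ ≤ 1) :
    ‖nuTmul C x y‖ ≤ 1 := by
  refine (norm_coe_algTensor (algTmul C x y)).trans_le (Real.sSup_le ?_ zero_le_one)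
  rintro r ⟨Z, _, _, _, φ, -, h, rfl⟩
  have hφ : TensorProduct.lift φ (algTmul C x y) = φ x y := TensorProduct.lift.tmul x y
  rw [hφ]
  exact (h x y).trans (mul_le_one₀ hx (norm_nonneg _) hy)

variable {K H : Type u}
  [NormedAddCommGroup K] [InnerProductSpace ℂ K] [CompleteSpace K]
  [NormedAddCommGroup H] [InnerProductSpace ℂ H] [CompleteSpace H]
  {E : NormalEmbedding C (NuTensor C X Y) K H}

/-- `w` has a representation whose coefficients have the sum `s`. -/
def HasRep (E : NormalEmbedding C (NuTensor C X Y) K H) (w : K →L[ℂ] H)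
    (s : C.toStarSubalgebra) : Prop :=
  ∃ (J : Type u) (c : J → C.toStarSubalgebra) (x : J → X) (y : J → Y),
    IsRepresentation C E w c x y s

namespace HasRep

variable {w w' : K →L[ℂ] H} {s s' : C.toStarSubalgebra}

theorem norm_le (h : HasRep E w s) : ‖w‖ ≤ ‖s‖ := by
  obtain ⟨J, c, x, y, h⟩ := h
  obtain ⟨w', hw', hsum⟩ := E.exists_hasWeakStarSum h.nonneg
    (fun j => norm_nuTmul_le_one (h.norm_left_le j) (h.norm_right_le j)) h.hasSum_coeff
  rwa [h.hasSum.unique hsum]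

theorem exists_hasWeakStarSum {I : Type u} {w : I → K →L[ℂ] H} {s : I → C.toStarSubalgebra}
    (h : ∀ i, HasRep E (w i) (s i)) {s₀ : C.toStarSubalgebra}
    (hs : HasWeakStarSum (fun i => (s i : H₀ →L[ℂ] H₀)) (s₀ : H₀ →L[ℂ] H₀)) :
    ∃ w₀, HasWeakStarSum w w₀ ∧ HasRep E w₀ s₀ := by
  choose J c x y h using h
  have hc : ∀ p : Σ i, J i, 0 ≤ c p.1 p.2 := fun p => (h p.1).nonneg p.2
  have hsum := hasWeakStarSum_sigma (a := fun p : Σ i, J i => (c p.1 p.2 : H₀ →L[ℂ] H₀)) hc hs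
    fun i => (h i).hasSum_coeff
  obtain ⟨w₀, -, hw₀⟩ := E.exists_hasWeakStarSum hc
    (fun p => norm_nuTmul_le_one ((h p.1).norm_left_le p.2) ((h p.1).norm_right_le p.2)) hsum
  exact ⟨w₀, hw₀.sigma fun i => (h i).hasSum, _, _, _, _, hc, fun p => (h p.1).norm_left_le p.2,
    fun p => (h p.1).norm_right_le p.2, hsum, hw₀⟩

theorem of_hasSum {v : ℕ → K →L[ℂ] H} {t : ℕ → C.toStarSubalgebra}
    (h : ∀ n, HasRep E (v n) (t n)) (hv : HasSum v w) (ht : Summable fun n => ‖t n‖)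
    (hts : HasSum t s) : HasRep E w s := by
  have hv' : Summable fun n => ‖v n‖ :=
    .of_nonneg_of_le (fun n => norm_nonneg _) (fun n => (h n).norm_le) ht
  have hts' : HasSum (fun n => (t n : H₀ →L[ℂ] H₀)) (s : H₀ →L[ℂ] H₀) :=
    hts.map C.toStarSubalgebra.subtype continuous_subtype_val
  obtain ⟨w₀, hw₀, hrep⟩ := exists_hasWeakStarSum (fun n : ULift.{u} ℕ => h n.down)
    (hasWeakStarSum_ulift (f := fun n => (t n : H₀ →L[ℂ] H₀)) ht hts')
  rwa [(hasWeakStarSum_ulift hv' hv).unique hw₀]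

theorem zero : HasRep E 0 0 :=
  ⟨PEmpty, PEmpty.elim, PEmpty.elim, PEmpty.elim, nofun, nofun, nofun,
    hasWeakStarSum_fintype (J := PEmpty) _, hasWeakStarSum_fintype (J := PEmpty) _⟩

theorem smul_nuTmul {c : C.toStarSubalgebra} (hc : 0 ≤ c) {x : X} {y : Y} (hx : ‖x‖ ≤ 1)
    (hy : ‖y‖ ≤ 1) : HasRep E (E.emb (c • nuTmul C x y)) c :=
  ⟨PUnit, fun _ => c, fun _ => x, fun _ => y, fun _ => hc, fun _ => hx, fun _ => hy,
    by simpa using hasWeakStarSum_fintype fun _ : PUnit.{u + 1} => (c : H₀ →L[ℂ] H₀),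
    by simpa using hasWeakStarSum_fintype fun _ : PUnit.{u + 1} => E.emb (c • nuTmul C x y)⟩

theorem add (h : HasRep E w s) (h' : HasRep E w' s') : HasRep E (w + w') (s + s') := by
  let pair {A : Type u} (a b : A) (i : ULift.{u} Bool) : A := cond i.down a b
  have hsum {A B : Type u} [NormedAddCommGroup A] [InnerProductSpace ℂ A] [NormedAddCommGroup B]
      [InnerProductSpace ℂ B] (S T : A →L[ℂ] B) : HasWeakStarSum (pair S T) (S + T) := by
    simpa [← Equiv.ulift.symm.sum_comp, pair] using hasWeakStarSum_fintype (pair S T)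
  obtain ⟨w₀, hw₀, hrep⟩ := exists_hasWeakStarSum (w := pair w w') (s := pair s s')
    (by rintro ⟨_ | _⟩ <;> assumption) (s₀ := s + s') (by
      convert hsum (s : H₀ →L[ℂ] H₀) (s' : H₀ →L[ℂ] H₀) using 2 with ⟨_ | _⟩ <;> rfl)
  rwa [(hsum w w').unique hw₀]

theorem of_mem_decompositions (E : NormalEmbedding C (NuTensor C X Y) K H)
    {d : AlgTensor C X Y × C.toStarSubalgebra} (hd : d ∈ decompositions C X Y) :
    HasRep E (E.emb (d.1 : NuTensor C X Y)) d.2 := by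
  induction hd using AddSubmonoid.closure_induction with
  | mem d hd =>
    obtain ⟨c, x, y, hc, rfl⟩ := hd
    obtain ⟨x', hx', hx⟩ := exists_norm_le_one_smul_eq x
    obtain ⟨y', hy', hy⟩ := exists_norm_le_one_smul_eq y
    have hmul : c • algTmul C x y = (((‖x‖ * ‖y‖ : ℝ) : ℂ) • c) • algTmul C x' y' := by
      conv_lhs => rw [← hx, ← hy, algTmul_complex_smul_left, algTmul_complex_smul_right]
      rw [smul_smul, ← Complex.ofReal_mul, smul_comm, smul_assoc]
    have h := smul_nuTmul (E := E) (c := ((‖x‖ * ‖y‖ : ℝ) : ℂ) • c)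
      (by rw [Complex.coe_smul]; exact smul_nonneg (by positivity) hc) hx' hy'
    rwa [hmul, coe_smul_algTensor]
  | zero => simpa [UniformSpace.Completion.coe_zero] using zero (E := E)
  | add d e _ _ hd he => simpa [UniformSpace.Completion.coe_add] using hd.add he

end HasRep

end Representations

section LocalRepresentations

variable {H₀ : Type u} [NormedAddCommGroup H₀] [InnerProductSpace ℂ H₀] [CompleteSpace H₀]
  {C : VonNeumannAlgebra H₀}

theorem norm_le_of_le_smul_one {s : C.toStarSubalgebra} (hs : 0 ≤ s) {r : ℝ} (hr : 0 ≤ r)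
    (hsr : s ≤ (r : ℂ) • 1) : ‖s‖ ≤ r := by
  refine (CStarAlgebra.norm_le_norm_of_nonneg_of_le (A := H₀ →L[ℂ] H₀) hs hsr).trans ?_
  refine (norm_smul_le (r : ℂ) (1 : H₀ →L[ℂ] H₀)).trans ?_
  rw [Complex.norm_of_nonneg hr]
  exact mul_le_of_le_one_right hr ContinuousLinearMap.norm_id_le

variable [IsMulCommutative C.toStarSubalgebra]
  {X Y : Type u}
  [NormedAddCommGroup X] [NormedSpace ℂ X] [Module C.toStarSubalgebra X]
  [IsScalarTower ℂ C.toStarSubalgebra X]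
  [NormedAddCommGroup Y] [NormedSpace ℂ Y] [Module C.toStarSubalgebra Y]
  [IsScalarTower ℂ C.toStarSubalgebra Y]
  {K H : Type u}
  [NormedAddCommGroup K] [InnerProductSpace ℂ K] [CompleteSpace K]
  [NormedAddCommGroup H] [InnerProductSpace ℂ H] [CompleteSpace H]
  {E : NormalEmbedding C (NuTensor C X Y) K H} {w : K →L[ℂ] H} {δ : ℝ}

theorem emb_coe_smul (E : NormalEmbedding C (NuTensor C X Y) K H) (c : C.toStarSubalgebra)
    (v : AlgTensor C X Y) :
    E.emb ((c • v : AlgTensor C X Y) : NuTensor C X Y) =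
      E.left c ∘L E.emb (v : NuTensor C X Y) := by
  rw [coe_smul_algTensor, E.emb_left]

theorem exists_local_algTensor_approx (hw : w ∈ E.strongHull) (hδ : 0 < δ)
    {q : C.toStarSubalgebra} (hq : IsStarProjection q) (hq0 : q ≠ 0) :
    ∃ p : C.toStarSubalgebra, IsStarProjection p ∧ p ≠ 0 ∧ p * q = p ∧
      ∃ v : AlgTensor C X Y, ‖E.left p ∘L (w - E.emb (v : NuTensor C X Y))‖ ≤ δ := by
  obtain ⟨p, hp, hp0, hpq, _, ⟨z, rfl⟩, hz⟩ :=
    isLocalLimit_of_mem_strongHull hw (δ / 2) (half_pos hδ) q hq hq0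
  obtain ⟨v, hv⟩ := UniformSpace.Completion.denseRange_coe.exists_dist_lt z (half_pos hδ)
  have hzv : ‖E.emb z - E.emb (v : NuTensor C X Y)‖ ≤ δ / 2 := by
    rw [← map_sub, E.emb.norm_map, ← dist_eq_norm]
    exact hv.le
  refine ⟨p, hp, hp0, hpq, v, ?_⟩
  calc ‖E.left p ∘L (w - E.emb (v : NuTensor C X Y))‖
      = ‖E.left p ∘L (w - E.emb z) + E.left p ∘L (E.emb z - E.emb (v : NuTensor C X Y))‖ := by
        rw [← ContinuousLinearMap.comp_add, sub_add_sub_cancel]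
    _ ≤ δ / 2 + δ / 2 :=
        norm_add_le_of_le hz ((norm_rep_projection_comp_le E.left hp _).trans hzv)
    _ = δ := add_halves δ

theorem exists_local_decomposition (hw : w ∈ E.strongHull) (hδ : 0 < δ)
    {q : C.toStarSubalgebra} (hq : IsStarProjection q) (hq0 : q ≠ 0) :
    ∃ p : C.toStarSubalgebra, IsStarProjection p ∧ p ≠ 0 ∧ p * q = p ∧
      ∃ d ∈ decompositions C X Y, p • d.1 = d.1 ∧ d.2 ≤ ((‖w‖ + δ : ℝ) : ℂ) • p ∧
        ‖E.left p ∘L (w - E.emb (d.1 : NuTensor C X Y))‖ ≤ δ := by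
  obtain ⟨e, he, he0, heq, v, hv⟩ := exists_local_algTensor_approx hw (half_pos hδ) hq hq0
  have hnu : nu C (e • v) < ‖w‖ + δ := by
    calc nu C (e • v) = ‖E.left e ∘L w - E.left e ∘L (w - E.emb (v : NuTensor C X Y))‖ := by
          rw [← norm_coe_algTensor, ← E.emb.norm_map, emb_coe_smul,
            ← ContinuousLinearMap.comp_sub, sub_sub_cancel]
      _ ≤ ‖w‖ + δ / 2 := norm_sub_le_of_le (norm_rep_projection_comp_le E.left he w) hv
      _ < ‖w‖ + δ := by linarith
  obtain ⟨p, s, hp, hp0, hpe, hd, hs⟩ := exists_projection_mul_le hnu he he0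
  refine ⟨p, hp, hp0, by rw [← hpe, mul_assoc, heq], _, projection_smul_mem_decompositions hp hd,
    ?_, hs, ?_⟩
  · rw [smul_smul, hp.1]
  · have hpv : p • e • v = p • v := by rw [smul_smul, hpe]
    rw [hpv, ContinuousLinearMap.comp_sub, emb_coe_smul, ← rep_mul_comp, hp.1,
      ← ContinuousLinearMap.comp_sub]
    exact ((norm_rep_projection_comp_mono E.left hp hpe _).trans hv).trans (half_le_self hδ.le)

theorem exists_partition_decomposition (hw : w ∈ E.strongHull) (hδ : 0 < δ) :
    ∃ (J : Type u) (p : J → C.toStarSubalgebra) (v : J → AlgTensor C X Y)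
      (s : J → C.toStarSubalgebra), IsPartition p ∧ (∀ j, (v j, s j) ∈ decompositions C X Y) ∧
      (∀ j, p j • v j = v j) ∧ (∀ j, s j ≤ ((‖w‖ + δ : ℝ) : ℂ) • p j) ∧
      ∀ j, ‖E.left (p j) ∘L (w - E.emb (v j : NuTensor C X Y))‖ ≤ δ := by
  obtain ⟨J, p, hp, h⟩ := exists_partition _ fun q => exists_local_decomposition hw hδ
  choose d hd hpd hs hnorm using h
  exact ⟨J, p, fun j => (d j).1, fun j => (d j).2, hp, hd, hpd, hs, hnorm⟩

theorem IsPartition.exists_hasWeakStarSum_of_le {J : Type u} {p s : J → C.toStarSubalgebra}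
    (hp : IsPartition p) (hs : ∀ j, 0 ≤ s j) {r : ℝ} (hr : 0 ≤ r)
    (hsp : ∀ j, s j ≤ (r : ℂ) • p j) :
    ∃ s₀ : C.toStarSubalgebra, ‖s₀‖ ≤ r ∧
      HasWeakStarSum (fun j => (s j : H₀ →L[ℂ] H₀)) (s₀ : H₀ →L[ℂ] H₀) := by
  have hsum : ∀ F : Finset J, ∑ j ∈ F, s j ≤ (r : ℂ) • 1 := fun F => by
    calc ∑ j ∈ F, s j ≤ (r : ℂ) • ∑ j ∈ F, p j := by
          rw [Finset.smul_sum]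
          exact Finset.sum_le_sum fun j _ => hsp j
      _ ≤ (r : ℂ) • 1 := by
          rw [Complex.coe_smul, Complex.coe_smul]
          exact smul_le_smul_of_nonneg_left
            (sub_nonneg.1 (hp.isStarProjection_sum F).one_sub.nonneg) hr
  obtain ⟨s₀, hs₀, hs₀r, hsum₀⟩ := exists_hasWeakStarSum_coe hs hsum
  exact ⟨s₀, norm_le_of_le_smul_one hs₀ hr hs₀r, hsum₀⟩

theorem exists_hasRep_approx (hw : w ∈ E.strongHull) (hδ : 0 < δ) :
    ∃ v ∈ E.strongHull, ∃ s, HasRep E v s ∧ ‖s‖ ≤ ‖w‖ + δ ∧ ‖w - v‖ ≤ δ := by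
  obtain ⟨J, p, v, s, hp, hd, hpv, hsp, hnorm⟩ := exists_partition_decomposition hw hδ
  obtain ⟨s₀, hs₀, hsum⟩ := hp.exists_hasWeakStarSum_of_le
    (fun j => nonneg_of_mem_decompositions (hd j)) (by positivity) hsp
  obtain ⟨w₀, hw₀, hrep⟩ :=
    HasRep.exists_hasWeakStarSum (fun j => HasRep.of_mem_decompositions E (hd j)) hsum
  obtain ⟨hstrong, hemb⟩ := (isLeast_strongHull E).1
  have hcut : ∀ j, E.left (p j) ∘L E.emb (v j : NuTensor C X Y) = E.emb (v j : NuTensor C X Y) :=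
    fun j => by rw [← emb_coe_smul, hpv]
  have hbdd : ∀ j, ‖E.emb (v j : NuTensor C X Y)‖ ≤ ‖w‖ + δ := fun j => by
    calc ‖E.emb (v j : NuTensor C X Y)‖
        = ‖E.left (p j) ∘L w - E.left (p j) ∘L (w - E.emb (v j : NuTensor C X Y))‖ := by
          rw [← ContinuousLinearMap.comp_sub, sub_sub_cancel, hcut]
      _ ≤ ‖w‖ + δ :=
          norm_sub_le_of_le (norm_rep_projection_comp_le E.left (hp.proj j) w) (hnorm j)
  have hw₀' : HasWeakStarSum (fun j => E.left (p j) ∘L E.emb (v j : NuTensor C X Y)) w₀ := by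
    simpa only [hcut] using hw₀
  have hmem : w₀ ∈ E.strongHull :=
    hstrong.sum_mem J p _ hp.proj hp.orth (fun j => hemb (v j)) ⟨_, hbdd⟩ w₀ hw₀'
  have hcentral := fun c => hstrong.central c _ (sub_mem hw hmem)
  refine ⟨w₀, hmem, s₀, hrep, hs₀, hp.norm_le E.left_normal E.right_normal hcentral hδ.le
    fun j => ?_⟩
  rw [ContinuousLinearMap.comp_sub, hw₀'.rep_comp_eq hp.orth (hp.proj j).1,
    ← ContinuousLinearMap.comp_sub]
  exact hnorm j

theorem exists_hasRep_norm_le (hw : w ∈ E.strongHull) {ε : ℝ} (hε : 0 < ε) :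
    ∃ s, HasRep E w s ∧ ‖s‖ ≤ ‖w‖ + ε := by
  obtain ⟨v, s, s₀, hrep, hvw, hs, hs₀, hnorm⟩ :=
    exists_series_of_approx (W := E.strongHull.toAddSubgroup) (R := HasRep E)
      (fun _ _ h => h.norm_le) (fun δ hδ u hu => exists_hasRep_approx hu hδ) hw hε
  exact ⟨s₀, .of_hasSum hrep hvw hs hs₀, hnorm⟩

theorem isGLB_norm_hasRep (hw : w ∈ E.strongHull) :
    IsGLB {r : ℝ | ∃ s, HasRep E w s ∧ r = ‖s‖} ‖w‖ := by
  refine ⟨?_, fun r hr => le_of_forall_pos_le_add fun ε hε => ?_⟩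
  · rintro _ ⟨s, hs, rfl⟩
    exact hs.norm_le
  · obtain ⟨s, hs, hle⟩ := exists_hasRep_norm_le hw hε
    exact (hr ⟨s, hs, rfl⟩).trans hle

end LocalRepresentations

section DirectSum

variable {I : Type*} {K H : I → Type*}
  [∀ i, NormedAddCommGroup (K i)] [∀ i, InnerProductSpace ℂ (K i)]
  [∀ i, NormedAddCommGroup (H i)] [∀ i, InnerProductSpace ℂ (H i)]

theorem norm_le_norm_mapCLM (T : ∀ i, K i →L[ℂ] H i) {M : ℝ} (hM : 0 ≤ M) (hT : ∀ i, ‖T i‖ ≤ M)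
    (i : I) : ‖T i‖ ≤ ‖lp.mapCLM 2 T hM hT‖ := by
  classical
  refine (T i).opNorm_le_bound (ContinuousLinearMap.opNorm_nonneg _) fun ξ => ?_
  have hcoord : lp.mapCLM 2 T hM hT (lp.single 2 i ξ) i = T i ξ :=
    congrArg (T i) (lp.single_apply_self 2 i ξ)
  calc ‖T i ξ‖ ≤ ‖lp.mapCLM 2 T hM hT (lp.single 2 i ξ)‖ :=
        hcoord ▸ lp.norm_apply_le_norm two_ne_zero _ i
    _ ≤ ‖lp.mapCLM 2 T hM hT‖ * ‖lp.single (E := K) 2 i ξ‖ := ContinuousLinearMap.le_opNorm _ _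
    _ = ‖lp.mapCLM 2 T hM hT‖ * ‖ξ‖ := by rw [lp.norm_single two_pos]

variable {H₀ : Type u} [NormedAddCommGroup H₀] [InnerProductSpace ℂ H₀] [CompleteSpace H₀]
  {C : VonNeumannAlgebra H₀} {I : Type u} {H : I → Type u}
  [∀ i, NormedAddCommGroup (H i)] [∀ i, InnerProductSpace ℂ (H i)] [∀ i, CompleteSpace (H i)]

/-- The Hilbert space direct sum of a family of `*`-representations of `C`. -/
def directSumRep (π : ∀ i, C.toStarSubalgebra →⋆ₐ[ℂ] (H i →L[ℂ] H i)) :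
    C.toStarSubalgebra →⋆ₐ[ℂ] (lp H 2 →L[ℂ] lp H 2) where
  toFun c := lp.mapCLM 2 (fun i => π i c) (norm_nonneg c) fun i => norm_rep_le (π i) c
  map_one' := by
    ext x i
    change π i 1 (x i) = x i
    rw [map_one, one_apply_eq_self]
  map_mul' a b := by
    ext x i
    change π i (a * b) (x i) = π i a (π i b (x i))
    rw [map_mul, mul_apply_eq_comp]
  map_zero' := by
    ext x i
    change π i 0 (x i) = 0
    rw [map_zero, zero_apply]
  map_add' a b := by
    ext x i
    change π i (a + b) (x i) = π i a (x i) + π i b (x i)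
    rw [map_add, add_apply]
  commutes' a := by
    ext x i
    change π i (algebraMap ℂ _ a) (x i) = a • x i
    rw [AlgHomClass.commutes, Algebra.algebraMap_eq_smul_one, smul_apply,
      one_apply_eq_self]
  map_star' a := by
    rw [ContinuousLinearMap.star_eq_adjoint, ContinuousLinearMap.eq_adjoint_iff]
    intro x y
    rw [lp.inner_eq_tsum, lp.inner_eq_tsum]
    refine tsum_congr fun i => ?_
    change ⟪π i (star a) (x i), y i⟫_ℂ = ⟪x i, π i a (y i)⟫_ℂ
    rw [map_star, ContinuousLinearMap.star_eq_adjoint, ContinuousLinearMap.adjoint_inner_left]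

theorem vecForm_directSumRep (π : ∀ i, C.toStarSubalgebra →⋆ₐ[ℂ] (H i →L[ℂ] H i))
    (c : C.toStarSubalgebra) (ξ : lp H 2) :
    vecForm ξ (directSumRep π c) = ∑' i, vecForm (ξ i) (π i c) := by
  rw [vecForm_apply, lp.inner_eq_tsum, Complex.re_tsum (lp.summable_inner ξ _)]
  rfl

theorem eventually_norm_le {ι : Type*} [Preorder ι] {f : ι → C.toStarSubalgebra} (hf : Monotone f)
    {s : C.toStarSubalgebra} (hs : ∀ i, f i ≤ s) (i₀ : ι) :
    ∀ᶠ i in atTop, ‖f i‖ ≤ ‖s‖ + ‖s - f i₀‖ := by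
  filter_upwards [eventually_ge_atTop i₀] with i hi
  calc ‖f i‖ = ‖s - (s - f i)‖ := by rw [sub_sub_cancel]
    _ ≤ ‖s‖ + ‖s - f i‖ := norm_sub_le _ _
    _ ≤ ‖s‖ + ‖s - f i₀‖ := by
      gcongr
      exact CStarAlgebra.norm_le_norm_of_nonneg_of_le (sub_nonneg.2 (hs i))
        (sub_le_sub_left (hf hi) s)

theorem isNormal_directSumRep {π : ∀ i, C.toStarSubalgebra →⋆ₐ[ℂ] (H i →L[ℂ] H i)}
    (hπ : ∀ i, IsNormal C (π i)) : IsNormal C (directSumRep π) := by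
  refine isNormal_of_tendsto_vecForm fun ι _ _ _ f s hf hs ξ => ?_
  obtain ⟨a₀⟩ := ‹Nonempty ι›
  simp only [vecForm_directSumRep]
  have hξ : Summable fun i => ‖ξ i‖ ^ 2 := by
    simpa using (lp.memℓp ξ).summable (by norm_num)
  refine tendsto_tsum_of_dominated_convergence
    (bound := fun i => (‖s‖ + ‖s - f a₀‖) * ‖ξ i‖ ^ 2) (hξ.mul_left _)
    (fun i => ((hπ i).tendstoWeak hf hs).vecForm (ξ i)) ?_
  filter_upwards [eventually_norm_le hf (fun a => hs.1 ⟨a, rfl⟩) a₀] with a ha i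
  calc ‖vecForm (ξ i) (π i (f a))‖ ≤ ‖ξ i‖ * ‖π i (f a) (ξ i)‖ :=
        (Complex.abs_re_le_norm _).trans (norm_inner_le_norm _ _)
    _ ≤ ‖ξ i‖ * ((‖s‖ + ‖s - f a₀‖) * ‖ξ i‖) := by
      gcongr
      exact (π i (f a)).le_of_opNorm_le ((norm_rep_le _ _).trans ha) _
    _ = (‖s‖ + ‖s - f a₀‖) * ‖ξ i‖ ^ 2 := by ring

end DirectSum

section NormalRep

variable {H₀ : Type u} [NormedAddCommGroup H₀] [InnerProductSpace ℂ H₀] [CompleteSpace H₀]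

/-- A contractive normal representation of a seminormed `C`-module `V`, as a module of operators
between normal Hilbert `C`-modules. Unlike a `NormalEmbedding` it need not be isometric. -/
structure NormalRep (C : VonNeumannAlgebra H₀) (V : Type u) [SeminormedAddCommGroup V]
    [NormedSpace ℂ V] [Module C.toStarSubalgebra V] where
  (K H : Type u)
  [normK : NormedAddCommGroup K]
  [innerK : InnerProductSpace ℂ K]
  [completeK : CompleteSpace K]
  [normH : NormedAddCommGroup H]
  [innerH : InnerProductSpace ℂ H]
  [completeH : CompleteSpace H]
  left : C.toStarSubalgebra →⋆ₐ[ℂ] (H →L[ℂ] H)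
  right : C.toStarSubalgebra →⋆ₐ[ℂ] (K →L[ℂ] K)
  left_normal : IsNormal C left
  right_normal : IsNormal C right
  map : V →ₗ[ℂ] (K →L[ℂ] H)
  norm_map_le : ∀ v, ‖map v‖ ≤ ‖v‖
  map_left : ∀ (c : C.toStarSubalgebra) v, map (c • v) = left c ∘L map v
  map_right : ∀ (c : C.toStarSubalgebra) v, map (c • v) = map v ∘L right c

namespace NormalRep

attribute [instance] normK innerK completeK normH innerH completeH

variable {C : VonNeumannAlgebra H₀} {V : Type u} [SeminormedAddCommGroup V] [NormedSpace ℂ V]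
  [Module C.toStarSubalgebra V]

/-- The Hilbert space direct sum of a family of contractive normal representations. -/
def directSum {I : Type u} (R : I → NormalRep C V) : NormalRep C V where
  K := lp (fun i => (R i).K) 2
  H := lp (fun i => (R i).H) 2
  left := directSumRep fun i => (R i).left
  right := directSumRep fun i => (R i).right
  left_normal := isNormal_directSumRep fun i => (R i).left_normal
  right_normal := isNormal_directSumRep fun i => (R i).right_normal
  map :=
    { toFun v := lp.mapCLM 2 (fun i => (R i).map v) (norm_nonneg v) fun i => (R i).norm_map_le v
      map_add' v w := by
        ext x i
        change (R i).map (v + w) (x i) = (R i).map v (x i) + (R i).map w (x i)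
        rw [map_add, add_apply]
      map_smul' a v := by
        ext x i
        change (R i).map (a • v) (x i) = a • (R i).map v (x i)
        rw [map_smul, smul_apply] }
  norm_map_le v := lp.norm_mapCLM_le 2 _ (norm_nonneg v) fun i => (R i).norm_map_le v
  map_left c v := by
    ext x i
    change (R i).map (c • v) (x i) = (R i).left c ((R i).map v (x i))
    rw [(R i).map_left, ContinuousLinearMap.comp_apply]
  map_right c v := by
    ext x i
    change (R i).map (c • v) (x i) = (R i).map v ((R i).right c (x i))
    rw [(R i).map_right, ContinuousLinearMap.comp_apply]

theorem norm_map_le_norm_directSum_map {I : Type u} (R : I → NormalRep C V) (i : I) (v : V) :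
    ‖(R i).map v‖ ≤ ‖(directSum R).map v‖ :=
  norm_le_norm_mapCLM (fun i => (R i).map v) (norm_nonneg v) (fun i => (R i).norm_map_le v) i

theorem exists_isometric (h : ∀ v : V, ∀ ε > 0, ∃ R : NormalRep C V, ‖v‖ - ε < ‖R.map v‖) :
    ∃ R : NormalRep C V, ∀ v, ‖R.map v‖ = ‖v‖ := by
  have happrox (i : V × ℕ) : ∃ R : NormalRep C V, ‖i.1‖ - 1 / (i.2 + 1 : ℝ) < ‖R.map i.1‖ :=
    h i.1 _ (by positivity)
  choose R hR using happrox
  refine ⟨directSum R, fun v => ((directSum R).norm_map_le v).antisymm ?_⟩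
  have hlim : Tendsto (fun n : ℕ => ‖v‖ - 1 / (n + 1 : ℝ)) atTop (𝓝 ‖v‖) := by
    simpa using tendsto_one_div_add_atTop_nhds_zero_nat.const_sub ‖v‖
  exact le_of_tendsto' hlim fun n =>
    (hR (v, n)).le.trans (norm_map_le_norm_directSum_map R (v, n) v)

end NormalRep

theorem exists_linearIsometry_completion {V F : Type*} [SeminormedAddCommGroup V]
    [NormedSpace ℂ V] [NormedAddCommGroup F] [NormedSpace ℂ F] [CompleteSpace F]
    (L : V →ₗᵢ[ℂ] F) :
    ∃ Φ : UniformSpace.Completion V →ₗᵢ[ℂ] F, ∀ v : V, Φ v = L v := by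
  let e : V →ₗ[ℂ] UniformSpace.Completion V :=
    (UniformSpace.Completion.toComplₗᵢ (𝕜 := ℂ) (E := V)).toLinearMap
  have hΦ (v : V) : L.toLinearMap.extendOfNorm e v = L v :=
    LinearMap.extendOfNorm_eq UniformSpace.Completion.denseRange_coe
      ⟨1, fun v => by simp [e]⟩ v
  refine ⟨⟨(L.toLinearMap.extendOfNorm e).toLinearMap, fun z => ?_⟩, hΦ⟩
  change ‖L.toLinearMap.extendOfNorm e z‖ = ‖z‖
  induction z using UniformSpace.Completion.induction_on with
  | hp => exact isClosed_eq (by fun_prop) (by fun_prop)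
  | ih v => rw [hΦ, L.norm_map, UniformSpace.Completion.norm_coe]

theorem isCNRM_completion {C : VonNeumannAlgebra H₀} {V : Type u} [SeminormedAddCommGroup V]
    [NormedSpace ℂ V] [Module C.toStarSubalgebra V]
    [UniformContinuousConstSMul C.toStarSubalgebra V]
    (h : ∀ v : V, ∀ ε > 0, ∃ R : NormalRep C V, ‖v‖ - ε < ‖R.map v‖) :
    IsCNRM C (UniformSpace.Completion V) := by
  obtain ⟨R, hR⟩ := NormalRep.exists_isometric h
  obtain ⟨Φ, hΦ⟩ := exists_linearIsometry_completion ⟨R.map, hR⟩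
  replace hΦ : ∀ v : V, Φ v = R.map v := hΦ
  refine ⟨inferInstance, R.K, R.H, _, _, _, _, _, inferInstance, ⟨{
    left := R.left
    right := R.right
    left_normal := R.left_normal
    right_normal := R.right_normal
    emb := Φ
    emb_left := fun c z => ?_
    emb_right := fun c z => ?_ }⟩⟩
  · induction z using UniformSpace.Completion.induction_on with
    | hp => exact isClosed_eq (Φ.continuous.comp (continuous_const_smul c)) (by fun_prop)
    | ih v => rw [← UniformSpace.Completion.coe_smul, hΦ, hΦ, R.map_left]
  · induction z using UniformSpace.Completion.induction_on with
    | hp => exact isClosed_eq (Φ.continuous.comp (continuous_const_smul c)) (by fun_prop)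
    | ih v => rw [← UniformSpace.Completion.coe_smul, hΦ, hΦ, R.map_right]

end NormalRep

section NuTensor

variable {H₀ : Type u} [NormedAddCommGroup H₀] [InnerProductSpace ℂ H₀] [CompleteSpace H₀]

theorem IsCNRM.map_complex_smul {C : VonNeumannAlgebra H₀} {V Z : Type u} [AddCommGroup V]
    [Module ℂ V] [Module C.toStarSubalgebra V] [IsScalarTower ℂ C.toStarSubalgebra V]
    [NormedAddCommGroup Z] [NormedSpace ℂ Z] [Module C.toStarSubalgebra Z] (hZ : IsCNRM C Z)
    (f : V →ₗ[C.toStarSubalgebra] Z) (a : ℂ) (v : V) : f (a • v) = a • f v := by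
  rw [← IsScalarTower.algebraMap_smul C.toStarSubalgebra a v, map_smul, hZ.algebraMap_smul]

variable {C : VonNeumannAlgebra H₀} [IsMulCommutative C.toStarSubalgebra]
  {X Y : Type u}
  [NormedAddCommGroup X] [NormedSpace ℂ X] [Module C.toStarSubalgebra X]
  [IsScalarTower ℂ C.toStarSubalgebra X]
  [NormedAddCommGroup Y] [NormedSpace ℂ Y] [Module C.toStarSubalgebra Y]
  [IsScalarTower ℂ C.toStarSubalgebra Y]

theorem exists_normalRep_lt (v : AlgTensor C X Y) {ε : ℝ} (hε : 0 < ε) :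
    ∃ R : NormalRep C (AlgTensor C X Y), ‖v‖ - ε < ‖R.map v‖ := by
  have hne : (nuSet C v).Nonempty :=
    ⟨_, C.commutant.toStarSubalgebra, _, _, _, 0, isCNRM_commutant, fun x y => by
      simpa using mul_nonneg (norm_nonneg x) (norm_nonneg y), rfl⟩
  obtain ⟨_, ⟨Z, _, _, _, φ, hZ, hφ, rfl⟩, hlt⟩ :=
    exists_lt_of_lt_csSup hne (sub_lt_self (nu C v) hε)
  let f : AlgTensor C X Y →ₗ[C.toStarSubalgebra] Z := TensorProduct.lift φ
  obtain ⟨-, K, H, _, _, _, _, _, _, ⟨E⟩⟩ := id hZ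
  refine ⟨{
    K := K
    H := H
    left := E.left
    right := E.right
    left_normal := E.left_normal
    right_normal := E.right_normal
    map :=
      { toFun := fun w => E.emb (f w)
        map_add' := fun w w' => by rw [map_add, map_add]
        map_smul' := fun a w => by rw [hZ.map_complex_smul, map_smul, RingHom.id_apply] }
    norm_map_le := fun w => (E.emb.norm_map (f w)).trans_le
      (le_csSup (nuSet_bddAbove C w) ⟨Z, _, _, _, φ, hZ, hφ, rfl⟩)
    map_left := fun c w => (congrArg E.emb (map_smul f c w)).trans (E.emb_left c (f w))
    map_right := fun c w => (congrArg E.emb (map_smul f c w)).trans (E.emb_right c (f w)) }, ?_⟩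
  exact hlt.trans_eq (E.emb.norm_map (f v)).symm

variable (C X Y) in
theorem isCNRM_nuTensor : IsCNRM C (NuTensor C X Y) :=
  isCNRM_completion fun v _ hε => exists_normalRep_lt v hε

end NuTensor

end CNRM

end

theorem mainTheorem8_general {H₀ : Type u} [NormedAddCommGroup H₀] [InnerProductSpace ℂ H₀]
    [CompleteSpace H₀] (C : VonNeumannAlgebra H₀) [IsMulCommutative C.toStarSubalgebra]
    (X Y : Type u)
    [NormedAddCommGroup X] [NormedSpace ℂ X] [Module C.toStarSubalgebra X]
    [IsScalarTower ℂ C.toStarSubalgebra X]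
    [NormedAddCommGroup Y] [NormedSpace ℂ Y] [Module C.toStarSubalgebra Y]
    [IsScalarTower ℂ C.toStarSubalgebra Y] :
    IsCNRM C (NuTensor C X Y) ∧
    ∀ (K H : Type u)
      [NormedAddCommGroup K] [InnerProductSpace ℂ K] [CompleteSpace K]
      [NormedAddCommGroup H] [InnerProductSpace ℂ H] [CompleteSpace H]
      (E : NormalEmbedding C (NuTensor C X Y) K H),
      IsLeast {W | IsStrong E.left E.right W ∧ ∀ z, E.emb z ∈ W} E.strongHull ∧
      ∀ w ∈ E.strongHull,
        (∃ (J : Type u) (c : J → C.toStarSubalgebra) (x : J → X) (y : J → Y)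
          (s : C.toStarSubalgebra), IsRepresentation C E w c x y s) ∧
        IsGLB {r : ℝ | ∃ (J : Type u) (c : J → C.toStarSubalgebra) (x : J → X) (y : J → Y)
          (s : C.toStarSubalgebra), IsRepresentation C E w c x y s ∧ r = ‖s‖} ‖w‖ := by
  refine ⟨isCNRM_nuTensor C X Y, fun K H _ _ _ _ _ _ E =>
    ⟨isLeast_strongHull E, fun w hw => ⟨?_, ?_⟩⟩⟩
  · obtain ⟨s, ⟨J, c, x, y, h⟩, -⟩ := exists_hasRep_norm_le hw one_pos
    exact ⟨J, c, x, y, s, h⟩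
  · convert isGLB_norm_hasRep hw using 1
    ext r
    constructor
    · rintro ⟨J, c, x, y, s, h, hr⟩
      exact ⟨s, ⟨J, c, x, y, h⟩, hr⟩
    · rintro ⟨s, ⟨J, c, x, y, h⟩, hr⟩
      exact ⟨J, c, x, y, s, h, hr⟩

theorem mainTheorem8 {H₀ : Type u} [NormedAddCommGroup H₀] [InnerProductSpace ℂ H₀]
    [CompleteSpace H₀] (C : VonNeumannAlgebra H₀) [IsMulCommutative C.toStarSubalgebra]
    (X Y : Type u)
    [NormedAddCommGroup X] [NormedSpace ℂ X] [Module C.toStarSubalgebra X]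
    [IsScalarTower ℂ C.toStarSubalgebra X]
    [NormedAddCommGroup Y] [NormedSpace ℂ Y] [Module C.toStarSubalgebra Y]
    [IsScalarTower ℂ C.toStarSubalgebra Y]
    (hX : IsCNRM C X) (hY : IsCNRM C Y) :
    IsCNRM C (NuTensor C X Y) ∧
    ∀ (K H : Type u)
      [NormedAddCommGroup K] [InnerProductSpace ℂ K] [CompleteSpace K]
      [NormedAddCommGroup H] [InnerProductSpace ℂ H] [CompleteSpace H]
      (E : NormalEmbedding C (NuTensor C X Y) K H),
      IsLeast {W | IsStrong E.left E.right W ∧ ∀ z, E.emb z ∈ W} E.strongHull ∧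
      ∀ w ∈ E.strongHull,
        (∃ (J : Type u) (c : J → C.toStarSubalgebra) (x : J → X) (y : J → Y)
          (s : C.toStarSubalgebra), IsRepresentation C E w c x y s) ∧
        IsGLB {r : ℝ | ∃ (J : Type u) (c : J → C.toStarSubalgebra) (x : J → X) (y : J → Y)
          (s : C.toStarSubalgebra), IsRepresentation C E w c x y s ∧ r = ‖s‖} ‖w‖ := by
  exact mainTheorem8_general C X Y
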